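/- Let $\Theta\subseteq(0,\infty)$ have non-empty interior. For $\vartheta\in\Theta$ let $X_t=\sum_{i=1}^{N_t}\varepsilon_i$, $t\ge 0$, where $(N_t)$ is a homogeneous Poisson process with intensity $\vartheta$ and, independently of it, the $\varepsilon_i$ are independent with $\mathbb P_\vartheta(\varepsilon_i=1)=\mathbb P_\vartheta(\varepsilon_i=-1)=\tfrac12$. For $0<\Delta\le T$ let $\mathbb P_\vartheta^{T,\Delta}$ be the law of $(X_\Delta,X_{2\Delta},\dots,X_{\lfloor T/\Delta\rfloor\Delta})$ on $\mathbb Z^{\lfloor T/\Delta\rfloor}$. A family of experiments $(\{Q_\vartheta^{T},\vartheta\in\Theta\})_{T>0}$ is LAN at $\vartheta\in\Theta$ with information (normalisation) $I_T>0$ if there are statistics $\xi_T$, not depending on $v$, with $\xi_T\to\mathcal N(0,1)$ in distribution under $Q^T_\vartheta$ as $T\to\infty$, and for every $v\in\mathbb R$ there are remainders $r_T=r_T(v)\to0$ in probability under $Q^T_\vartheta$ as $T\to\infty$, such that for every $T>0$ with $\vartheta+vI_T^{-1/2}\in\Theta$ one has $Q^T_{\vartheta+vI_T^{-1/2}}\ll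 Q^T_\vartheta$ and, $Q^T_\vartheta$-almost surely, $$\frac{dQ^T_{\vartheta+vI_T^{-1/2}}}{dQ^T_\vartheta}=\exp\big(v\,\xi_T-\tfrac12v^2+r_T\big).$$ For $T,\Delta>0$ put $$I_{T,\Delta}(\vartheta)=T\Delta\;\mathbb E_\vartheta\Big[\Big(\frac{\mathcal I_{|X_\Delta|+1}(\vartheta\Delta)}{\mathcal I_{|X_\Delta|}(\vartheta\Delta)}+\frac{|X_\Delta|}{\vartheta\Delta}-1\Big)^2\Big],\qquad \mathcal I_\nu(x)=\sum_{m\ge0}\frac{(x/2)^{2m+\nu}}{m!\,(\nu+m)!}.$$ Theorem 2 (the microscopic case). Let $0<\Delta_T\le T$ for all $T>0$ and $\Delta_T\to0$ as $T\to\infty$. Then for every $\vartheta\in\Theta$: (i) the family $(\{\mathbb P_\vartheta^{T,\Delta_T},\vartheta\in\Theta\})_{T>0}$ is LAN at $\vartheta$ with information $I_{T,\Delta_T}(\vartheta)$; (ii) $I_{T,\Delta_T}(\vartheta)\sim T/\vartheta$ as $T\to\infty$, that is, the ratio tends to $1$; (iii) for every $T>0$, $\lim_{\Delta\to0^+}I_{T,\Delta}(\vartheta)=T/\vartheta$;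 (iv) $T/\vartheta$ is the information obtained when the jump times of $N$ are observed: the family of experiments generated by observing the path $(N_t)_{0\le t\le T}$ is LAN at $\vartheta$ with information $T/\vartheta$. -/

import Mathlib

open MeasureTheory ProbabilityTheory Filter Topology Asymptotics
open scoped NNReal ENNReal

noncomputable section

namespace AcrossScales

/-- `N` is a homogeneous Poisson process with intensity `ϑ` under `P`: it starts at `0`, has
independent increments, `N t - N s` has the Poisson law of mean `ϑ (t - s)`, and almost every path
is nondecreasing and right-continuous. (Increments are taken in `ℤ`, so nothing is truncated.) -/
structure IsPoissonProcess {Ω : Type*} [MeasurableSpace Ω] (P : Measure Ω) (ϑ : ℝ)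
    (N : ℝ≥0 → Ω → ℕ) : Prop where
  measurable : ∀ t, Measurable (N t)
  start_zero : ∀ᵐ ω ∂P, N 0 ω = 0
  indep_increments : HasIndepIncrements (fun (t : ℝ≥0) (ω : Ω) => (N t ω : ℤ)) P
  increment_law : ∀ s t : ℝ≥0, s ≤ t →
    HasLaw (fun ω => (N t ω : ℤ) - (N s ω : ℤ))
      ((poissonMeasure (ϑ.toNNReal * (t - s))).map (fun n : ℕ => (n : ℤ))) P
  mono : ∀ᵐ ω ∂P, Monotone (fun t => N t ω)
  right_continuous : ∀ᵐ ω ∂P, ∀ t, ContinuousWithinAt (fun s => N s ω) (Set.Ici t) t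

/-- The ingredients of the compound Poisson process with intensity `ϑ` and symmetric Bernoulli
jumps: a Poisson process `N` of intensity `ϑ`, and, independent of it, independent signs `ε i`
with `P (ε i = 1) = P (ε i = -1) = 1 / 2`. -/
structure IsModel {Ω : Type*} [MeasurableSpace Ω] (P : Measure Ω) (ϑ : ℝ)
    (N : ℝ≥0 → Ω → ℕ) (ε : ℕ → Ω → ℤ) : Prop where
  isProbabilityMeasure : IsProbabilityMeasure P
  poisson : IsPoissonProcess P ϑ N
  measurable_sign : ∀ i, Measurable (ε i)
  sign_pos : ∀ i, P {ω | ε i ω = 1} = 1 / 2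
  sign_neg : ∀ i, P {ω | ε i ω = -1} = 1 / 2
  sign_indep : iIndepFun ε P
  indep : IndepFun (fun ω i => ε i ω) (fun ω t => N t ω) P

/-- The compound process `X t = ∑ ε i` over the first `N t` indices, started at `0`. -/
def compound {Ω : Type*} (N : ℝ≥0 → Ω → ℕ) (ε : ℕ → Ω → ℤ) (t : ℝ≥0) (ω : Ω) : ℤ :=
  ∑ i ∈ Finset.range (N t ω), ε i ω

/-- The law of the discrete observation `(X_Δ, X_{2Δ}, …, X_{nΔ})`, where `n = ⌊T / Δ⌋`. -/
def observationLaw {Ω : Type*} [MeasurableSpace Ω] (P : Measure Ω) (X : ℝ≥0 → Ω → ℤ) (T Δ : ℝ) :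
    Measure (Fin ⌊T / Δ⌋₊ → ℤ) :=
  P.map (fun ω i => X ((((i : ℕ) + 1 : ℝ) * Δ).toNNReal) ω)

/-- The law of the whole path `(N t)`, `0 ≤ t ≤ T`, i.e. of the jump times up to time `T`. -/
def pathLaw {Ω : Type*} [MeasurableSpace Ω] (P : Measure Ω) (N : ℝ≥0 → Ω → ℕ) (T : ℝ) :
    Measure ({t : ℝ≥0 // (t : ℝ) ≤ T} → ℕ) :=
  P.map (fun ω t => N t ω)

/-- Local asymptotic normality, at the point `ϑ`, of the experiments `(Q T ϑ')`, `ϑ' ∈ Θ`, as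
`T → ∞`, with normalisation `I T > 0`: there are statistics `ξ T` converging in law to `N(0,1)`
under `Q T ϑ` and, for every real `v`, remainders `r v T` converging to `0` in probability under
`Q T ϑ`, such that whenever `ϑ + v * (I T) ^ (-1/2) ∈ Θ` the likelihood ratio between this
parameter and `ϑ` is `exp (v ξ - v² / 2 + r)`. -/
def IsLAN {𝓧 : ℝ → Type*} [∀ T, MeasurableSpace (𝓧 T)] (Q : (T : ℝ) → ℝ → Measure (𝓧 T))
    (Θ : Set ℝ) (ϑ : ℝ) (I : ℝ → ℝ) : Prop :=
  (∀ T, 0 < T → 0 < I T) ∧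
  ∃ _ : ∀ T, IsProbabilityMeasure (Q T ϑ),
  ∃ ξ : (T : ℝ) → 𝓧 T → ℝ,
    (∀ T, Measurable (ξ T)) ∧
    TendstoInDistribution ξ atTop (id : ℝ → ℝ) (fun T => Q T ϑ) (gaussianReal 0 1) ∧
    ∀ v : ℝ, ∃ r : (T : ℝ) → 𝓧 T → ℝ,
      (∀ T, Measurable (r T)) ∧
      (∀ T, 0 < T → ϑ + v / √(I T) ∈ Θ →
        Q T (ϑ + v / √(I T)) ≪ Q T ϑ ∧
        ∀ᵐ x ∂(Q T ϑ), ((Q T (ϑ + v / √(I T))).rnDeriv (Q T ϑ) x).toReal =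
          Real.exp (v * ξ T x - v ^ 2 / 2 + r T x)) ∧
      ∀ δ : ℝ, 0 < δ → Tendsto (fun T => Q T ϑ {x | δ ≤ |r T x|}) atTop (𝓝 0)

/-- The modified Bessel function of the first kind, of order `ν ∈ ℕ`. -/
def besselI (ν : ℕ) (x : ℝ) : ℝ :=
  ∑' m : ℕ, (x / 2) ^ (2 * m + ν) / ((m.factorial : ℝ) * ((ν + m).factorial : ℝ))

/-- `h_Δ(ϑ, k) = I_{|k|+1}(ϑΔ) / I_{|k|}(ϑΔ)`. -/
def besselRatio (Δ ϑ : ℝ) (k : ℤ) : ℝ :=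
  besselI (k.natAbs + 1) (ϑ * Δ) / besselI k.natAbs (ϑ * Δ)

/-- `I_{T,Δ}(ϑ) = T Δ E[(h_Δ(ϑ, X_Δ) + (ϑΔ)⁻¹ |X_Δ| - 1)²]`. -/
def information {Ω : Type*} [MeasurableSpace Ω] (P : Measure Ω) (X : ℝ≥0 → Ω → ℤ) (ϑ T Δ : ℝ) :
    ℝ :=
  T * Δ * ∫ ω, (besselRatio Δ ϑ (X Δ.toNNReal ω) +
    (ϑ * Δ)⁻¹ * |((X Δ.toNNReal ω : ℤ) : ℝ)| - 1) ^ 2 ∂P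

end AcrossScales

end

/-! Over a step of length `Δ` the process increment has the Skellam law `exp (-λ) * besselI |k| λ`
with `λ = ϑ * Δ`: condition on the Poisson number of jumps and sum the random walk probabilities.
Increments over disjoint steps are independent (`IsModel.measureReal_increments`), so the
observation is an i.i.d. sample and its log-likelihood ratio is a sum of `n = ⌊T / Δ⌋₊` terms. When
`Δ` is small, an increment is `±1` with probability about `λ / 2` each, and all other nonzero values
have total probability `O(λ²)`. `tendsto_integral_skellam` turns this into one limit theorem for
`λ⁻¹ ∫ f`. The score at `k` is `|k| / ϑ + O(Δ)` uniformly in `k`, so its second moment is asymptotic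
to `Δ / ϑ`. This gives both statements about the information, since it is linear in `T`. For LAN,
put `u = v / √I`. `abs_log_skellamProb_sub_le` writes each log ratio as `u * score + |k| * (log (1 +
u / ϑ) - u / ϑ)` up to `O(u² Δ²)` uniformly in `k`. Since `u² T` converges, the `n` errors add up to
`O(Δ)`. The scores are centred (`integral_score`), and characteristic functions give their central
limit theorem (`tendsto_integral_exp_sum_score`). The sum of the `|k|` obeys an `L²` law of large
numbers (`tendsto_integral_sum_abs_sub_sq`), which makes the logarithmic term converge to `-v² / 2`.
For the observed path, the density is `exp (N_T * log (ϑ' / ϑ) - (ϑ' - ϑ) * T)`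
(`IsPoissonProcess.pathLaw_eq_withDensity`). It depends on the path only through the Poisson
variable `N_T`, and the same logarithmic expansion applies with `N_T` in place of the sum of the
`|k|`. -/

namespace AcrossScales

/-! ### Random walk probabilities and their Poisson mixture. -/

/-- The probability that a simple symmetric random walk sits at `k` after `n` steps. -/
noncomputable def walkProb : ℕ → ℤ → ℝ
  | 0, k => if k = 0 then 1 else 0
  | n + 1, k => (walkProb n (k - 1) + walkProb n (k + 1)) / 2

lemma walkProb_nonneg (n : ℕ) (k : ℤ) : 0 ≤ walkProb n k := by
  induction n generalizing k with
  | zero => simp only [walkProb]; split_ifs <;> norm_num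
  | succ n ih => have := ih (k - 1); have := ih (k + 1); simp only [walkProb]; positivity

lemma walkProb_le_one (n : ℕ) (k : ℤ) : walkProb n k ≤ 1 := by
  induction n generalizing k with
  | zero => simp only [walkProb]; split_ifs <;> norm_num
  | succ n ih => have := ih (k - 1); have := ih (k + 1); simp only [walkProb]; linarith

lemma walkProb_neg (n : ℕ) (k : ℤ) : walkProb n (-k) = walkProb n k := by
  induction n generalizing k with
  | zero => simp [walkProb]
  | succ n ih =>
    simp only [walkProb]
    rw [← ih (k - 1), ← ih (k + 1), add_comm]
    congr 3 <;> ring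

lemma walkProb_eq_zero {n : ℕ} {k : ℤ} (h : ∀ j : ℕ, k ≠ n - 2 * j) : walkProb n k = 0 := by
  induction n generalizing k with
  | zero => simp only [walkProb]; rw [if_neg]; simpa using h 0
  | succ n ih =>
    simp only [walkProb]
    rw [ih, ih]
    · norm_num
    · intro j hj; apply h (j + 1); push_cast; omega
    · intro j hj; apply h j; push_cast; omega

lemma walkProb_sub_two_mul (n j : ℕ) : walkProb n (n - 2 * j) = (n.choose j : ℝ) / 2 ^ n := by
  induction n generalizing j with
  | zero =>
    rcases j with _ | j
    · simp [walkProb]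
    · simp only [walkProb]; rw [if_neg (by push_cast; omega)]; simp
  | succ n ih =>
    simp only [walkProb]
    rcases j with _ | j
    · have h1 := ih 0
      rw [show ((n + 1 : ℕ) : ℤ) - 2 * ((0 : ℕ) : ℤ) - 1 = n - 2 * ((0 : ℕ) : ℤ) by push_cast; ring,
        h1, walkProb_eq_zero (n := n)]
      · simp [pow_succ]; ring
      · intro j; push_cast; omega
    · rw [show ((n + 1 : ℕ) : ℤ) - 2 * ((j + 1 : ℕ) : ℤ) - 1 = n - 2 * ((j + 1 : ℕ) : ℤ) by
          push_cast; ring, ih,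
        show ((n + 1 : ℕ) : ℤ) - 2 * ((j + 1 : ℕ) : ℤ) + 1 = n - 2 * (j : ℤ) by push_cast; ring, ih,
        Nat.choose_succ_succ]
      push_cast
      rw [pow_succ]
      ring

/-- The probability that a compound Poisson sum of mean number of signs `lam` equals `k`. -/
noncomputable def skellamProb (lam : ℝ) (k : ℤ) : ℝ := Real.exp (-lam) * besselI k.natAbs lam

/-- By parity and range only `n = 2 * m + k` contributes, and `choose (2m+k) m * m! * (k+m)! =
(2m+k)!` turns the Poisson weight times the binomial probability into the `m`-th Bessel term. -/
lemma tsum_poisson_mul_walkProb_nat (lam : ℝ) (k : ℕ) :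
    ∑' n : ℕ, (Real.exp (-lam) * lam ^ n / n.factorial) * walkProb n k = skellamProb lam k := by
  have hinj : Function.Injective (fun m : ℕ => 2 * m + k) := fun a b h => by simpa using h
  rw [← hinj.tsum_eq]
  · rw [skellamProb, besselI, ← tsum_mul_left]
    refine tsum_congr fun m => ?_
    have h := walkProb_sub_two_mul (2 * m + k) m
    rw [show ((2 * m + k : ℕ) : ℤ) - 2 * m = k by push_cast; ring] at h
    rw [h, Int.natAbs_natCast, div_pow]
    have h2 : ((2 * m + k).choose m : ℝ) * m.factorial * (k + m).factorial
        = (2 * m + k).factorial := by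
      have := Nat.choose_mul_factorial_mul_factorial (n := 2 * m + k) (k := m) (by omega)
      rw [show 2 * m + k - m = k + m by omega] at this
      exact_mod_cast this
    have := Nat.factorial_pos m
    have := Nat.factorial_pos (k + m)
    have := Nat.factorial_pos (2 * m + k)
    rw [← h2]
    field_simp
    rw [mul_comm]
    have : ((2 * m + k).choose m : ℝ) ≠ 0 := by
      exact_mod_cast (Nat.choose_pos (by omega)).ne'
    field_simp
  · intro n hn
    by_contra hc
    apply hn
    simp only
    rw [walkProb_eq_zero, mul_zero]
    intro j hj
    exact hc ⟨j, by simp only; omega⟩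

lemma tsum_poisson_mul_walkProb (lam : ℝ) (k : ℤ) :
    ∑' n : ℕ, (Real.exp (-lam) * lam ^ n / n.factorial) * walkProb n k = skellamProb lam k := by
  obtain ⟨j, rfl | rfl⟩ := k.eq_nat_or_neg
  · exact tsum_poisson_mul_walkProb_nat lam j
  · simp_rw [walkProb_neg]
    rw [tsum_poisson_mul_walkProb_nat]
    simp [skellamProb]

/-! ### Bessel series: derivatives, and bounds uniform in the order. -/

/-- The entire function `∑ z ^ m / (m! (k + m)!)`. -/
noncomputable def besselSeries (k : ℕ) (z : ℝ) : ℝ :=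
  ∑' m : ℕ, z ^ m / ((m.factorial : ℝ) * ((k + m).factorial : ℝ))

lemma besselI_eq (k : ℕ) (x : ℝ) : besselI k x = (x / 2) ^ k * besselSeries k ((x / 2) ^ 2) := by
  rw [besselI, besselSeries, ← tsum_mul_left]
  refine tsum_congr fun m => ?_
  rw [pow_add, pow_mul]
  ring

lemma norm_besselSeries_term_le (k m : ℕ) (z : ℝ) :
    ‖z ^ m / ((m.factorial : ℝ) * ((k + m).factorial : ℝ))‖ ≤ |z| ^ m / m.factorial := by
  rw [Real.norm_eq_abs, abs_div, abs_pow, abs_of_pos (by positivity : (0:ℝ) < m.factorial * _)]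
  gcongr
  have : (1:ℝ) ≤ (k + m).factorial := by exact_mod_cast Nat.factorial_pos _
  have : (0:ℝ) < m.factorial := by positivity
  nlinarith

lemma summable_besselSeries (k : ℕ) (z : ℝ) :
    Summable fun m : ℕ => z ^ m / ((m.factorial : ℝ) * ((k + m).factorial : ℝ)) :=
  .of_norm_bounded (Real.summable_pow_div_factorial |z|) fun m => norm_besselSeries_term_le k m z

lemma besselSeries_eq_add (k : ℕ) (z : ℝ) :
    besselSeries k z = 1 / (k.factorial : ℝ) +
      ∑' m : ℕ, z ^ (m + 1) / (((m + 1).factorial : ℝ) * ((k + (m + 1)).factorial : ℝ)) := by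
  rw [besselSeries, (summable_besselSeries k z).tsum_eq_zero_add]
  simp

/-- Termwise differentiation: the term of degree `m + 1` in the series of order `k` differentiates
to the term of degree `m` in that of order `k + 1`. The constant term is split off so that the
indices match. -/
lemma hasDerivAt_besselSeries (k : ℕ) (z : ℝ) :
    HasDerivAt (besselSeries k) (besselSeries (k + 1) z) z := by
  have hfun : besselSeries k = fun z => 1 / (k.factorial : ℝ) +
      ∑' m : ℕ, z ^ (m + 1) / (((m + 1).factorial : ℝ) * ((k + (m + 1)).factorial : ℝ)) :=
    funext (besselSeries_eq_add k)
  rw [hfun]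
  refine HasDerivAt.const_add _ ?_
  refine hasDerivAt_tsum_of_isPreconnected (t := Metric.ball (0:ℝ) (|z| + 1))
    (y₀ := z)
    (Real.summable_pow_div_factorial (|z| + 1)) Metric.isOpen_ball
    (convex_ball _ _).isPreconnected (g := fun m z => z ^ (m + 1) /
      (((m + 1).factorial : ℝ) * ((k + (m + 1)).factorial : ℝ)))
    (g' := fun m z => z ^ m / ((m.factorial : ℝ) * ((k + 1 + m).factorial : ℝ))) ?_ ?_ ?_ ?_ ?_
  · intro m y _
    have := (hasDerivAt_pow (m + 1) y).div_const
      (((m + 1).factorial : ℝ) * ((k + (m + 1)).factorial : ℝ))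
    convert! this using 1
    rw [Nat.factorial_succ m, show k + (m + 1) = k + 1 + m by ring]
    push_cast
    have := Nat.factorial_pos m
    have := Nat.factorial_pos (k + 1 + m)
    field_simp
  · intro m y hy
    refine (norm_besselSeries_term_le (k + 1) m y).trans ?_
    gcongr
    simpa using (mem_ball_zero_iff.mp hy).le
  · simp
  · exact ((summable_nat_add_iff 1).mpr (summable_besselSeries k z))
  · simp

lemma besselSeries_ge {k : ℕ} {z : ℝ} (hz : 0 ≤ z) : 1 / (k.factorial : ℝ) ≤ besselSeries k z := by
  rw [besselSeries_eq_add]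
  have : 0 ≤ ∑' m : ℕ, z ^ (m + 1) / (((m + 1).factorial : ℝ) * ((k + (m + 1)).factorial : ℝ)) :=
    tsum_nonneg fun m => by positivity
  linarith

lemma besselSeries_pos {k : ℕ} {z : ℝ} (hz : 0 ≤ z) : 0 < besselSeries k z :=
  lt_of_lt_of_le (by positivity) (besselSeries_ge hz)

lemma besselSeries_le {k : ℕ} {z : ℝ} (hz : 0 ≤ z) :
    besselSeries k z ≤ Real.exp z / k.factorial := by
  rw [Real.exp_eq_exp_ℝ, NormedSpace.exp_eq_tsum_div, ← tsum_div_const, besselSeries]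
  refine (summable_besselSeries k z).tsum_le_tsum (fun m => ?_)
    ((Real.summable_pow_div_factorial z).div_const _)
  rw [div_div]
  gcongr
  omega

lemma besselSeries_succ_le {k : ℕ} {z : ℝ} (hz : 0 ≤ z) :
    besselSeries (k + 1) z ≤ besselSeries k z := by
  refine (summable_besselSeries (k + 1) z).tsum_le_tsum (fun m => ?_) (summable_besselSeries k z)
  gcongr
  omega

lemma besselSeries_recurrence (k : ℕ) (z : ℝ) :
    besselSeries k z - z * besselSeries (k + 2) z = (k + 1) * besselSeries (k + 1) z := by
  rw [besselSeries_eq_add k, besselSeries_eq_add (k + 1), besselSeries, ← tsum_mul_left,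
    mul_add, ← tsum_mul_left, add_sub_assoc, ← Summable.tsum_sub]
  · congr 1
    · rw [Nat.factorial_succ]; push_cast; field_simp
    · refine tsum_congr fun m => ?_
      rw [show k + 2 + m = (k + m + 1) + 1 by ring, show k + 1 + (m + 1) = (k + m + 1) + 1 by ring,
        show k + (m + 1) = k + m + 1 by ring, Nat.factorial_succ (k + m + 1), Nat.factorial_succ m]
      push_cast
      have := Nat.factorial_pos m
      have := Nat.factorial_pos (k + m + 1)
      field_simp
      ring
  · exact (summable_nat_add_iff 1).mpr (summable_besselSeries k z)
  · exact (summable_besselSeries (k + 2) z).mul_left z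

/-- The logarithmic derivative of `besselSeries k`. -/
noncomputable def besselSlope (k : ℕ) (z : ℝ) : ℝ := besselSeries (k + 1) z / besselSeries k z

lemma besselSlope_nonneg {k : ℕ} {z : ℝ} (hz : 0 ≤ z) : 0 ≤ besselSlope k z :=
  div_nonneg (besselSeries_pos hz).le (besselSeries_pos hz).le

lemma besselSlope_le_one {k : ℕ} {z : ℝ} (hz : 0 ≤ z) : besselSlope k z ≤ 1 :=
  (div_le_one (besselSeries_pos hz)).mpr (besselSeries_succ_le hz)

lemma hasDerivAt_besselSlope {k : ℕ} {z : ℝ} (hz : 0 ≤ z) :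
    HasDerivAt (besselSlope k)
      (besselSlope (k + 1) z * besselSlope k z - besselSlope k z ^ 2) z := by
  have h1 := besselSeries_pos (k := k) hz
  have h2 := besselSeries_pos (k := k + 1) hz
  convert! (hasDerivAt_besselSeries (k + 1) z).div (hasDerivAt_besselSeries k z) h1.ne' using 1
  simp only [besselSlope]
  field_simp

/-- The derivative is a difference of two products of slopes, each in `[0, 1]`, hence is at most `1`
in absolute value whatever the order `k`. -/
lemma abs_besselSlope_sub_le {k : ℕ} {z z' : ℝ} (hz : 0 ≤ z) (hz' : 0 ≤ z') :
    |besselSlope k z' - besselSlope k z| ≤ |z' - z| := by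
  have := (convex_Ici (0:ℝ)).norm_image_sub_le_of_norm_hasDerivWithin_le (f := besselSlope k)
    (C := 1) (fun x hx => (hasDerivAt_besselSlope hx).hasDerivWithinAt) (fun x hx => ?_) hz hz'
  · simpa using this
  · have a1 := besselSlope_nonneg (k := k) hx
    have a2 := besselSlope_le_one (k := k) hx
    have b1 := besselSlope_nonneg (k := k + 1) hx
    have b2 := besselSlope_le_one (k := k + 1) hx
    rw [Real.norm_eq_abs, abs_le]
    constructor <;> nlinarith

/-- Mean value inequality for the function minus its tangent, using the Lipschitz bound on the
slope. The constant does not depend on `k`, which allows the remainders of all observed increments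
to be summed. -/
lemma abs_log_besselSeries_sub_le {k : ℕ} {z z' : ℝ} (hz : 0 ≤ z) (hz' : 0 ≤ z') :
    |Real.log (besselSeries k z') - Real.log (besselSeries k z) - (z' - z) * besselSlope k z|
      ≤ (z' - z) ^ 2 := by
  have hsub : ∀ x ∈ Set.uIcc z z', 0 ≤ x := fun x hx => (le_min hz hz').trans hx.1
  have := (convex_uIcc z z').norm_image_sub_le_of_norm_hasDerivWithin_le
    (f := fun x => Real.log (besselSeries k x) - x * besselSlope k z)
    (f' := fun x => besselSlope k x - besselSlope k z)
    (C := |z' - z|) (fun x hx => ?_) (fun x hx => ?_) Set.left_mem_uIcc Set.right_mem_uIcc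
  · rw [Real.norm_eq_abs, Real.norm_eq_abs, abs_mul_abs_self, ← sq] at this
    convert! this using 2
    ring
  · have h1 := (hasDerivAt_besselSeries k x).log (besselSeries_pos (hsub x hx)).ne'
    have h2 := (hasDerivAt_id x).mul_const (besselSlope k z)
    convert! (h1.sub h2).hasDerivWithinAt using 1
    simp [besselSlope]
  · rw [Real.norm_eq_abs]
    exact (abs_besselSlope_sub_le hz (hsub x hx)).trans (Set.abs_sub_left_of_mem_uIcc hx)


/-! ### The Skellam law and Bessel recurrences. -/

lemma skellamProb_eq (lam : ℝ) (k : ℤ) : skellamProb lam k =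
    Real.exp (-lam) * ((lam / 2) ^ k.natAbs * besselSeries k.natAbs ((lam / 2) ^ 2)) := by
  rw [skellamProb, besselI_eq]

lemma skellamProb_pos {lam : ℝ} (h : 0 < lam) (k : ℤ) : 0 < skellamProb lam k := by
  rw [skellamProb_eq]
  have := besselSeries_pos (k := k.natAbs) (sq_nonneg (lam / 2))
  positivity

lemma skellamProb_le {lam : ℝ} (h : 0 < lam) (k : ℤ) : skellamProb lam k ≤
    Real.exp ((lam / 2) ^ 2 - lam) * ((lam / 2) ^ k.natAbs / k.natAbs.factorial) := by
  rw [skellamProb_eq, sub_eq_neg_add, Real.exp_add]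
  have := besselSeries_le (k := k.natAbs) (sq_nonneg (lam / 2))
  calc _ ≤ Real.exp (-lam) * ((lam / 2) ^ k.natAbs *
        (Real.exp ((lam / 2) ^ 2) / k.natAbs.factorial)) := by gcongr
    _ = _ := by ring

lemma besselRatio_eq {Δ ϑ : ℝ} (hϑ : 0 < ϑ) (hΔ : 0 < Δ) (k : ℤ) : besselRatio Δ ϑ k =
    ϑ * Δ / 2 * besselSlope k.natAbs ((ϑ * Δ / 2) ^ 2) := by
  have := besselSeries_pos (k := k.natAbs) (sq_nonneg (ϑ * Δ / 2))
  rw [besselRatio, besselI_eq, besselI_eq, besselSlope]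
  field_simp
  ring

lemma besselI_recurrence {x : ℝ} (hx : 0 < x) (j : ℕ) :
    besselI j x - besselI (j + 2) x = 2 * (j + 1) / x * besselI (j + 1) x := by
  have := besselSeries_recurrence j ((x / 2) ^ 2)
  rw [besselI_eq, besselI_eq, besselI_eq]
  calc _ = (x / 2) ^ j * (besselSeries j ((x / 2) ^ 2) -
        (x / 2) ^ 2 * besselSeries (j + 2) ((x / 2) ^ 2)) := by ring
    _ = _ := by rw [this]; field_simp; ring

/-- The three-term recurrence in a form symmetric in the sign of `k`; it is what makes the score
times the probability a discrete Laplacian. -/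
lemma besselI_natAbs_recurrence {x : ℝ} (hx : 0 < x) (k : ℤ) :
    besselI (k.natAbs + 1) x + |(k : ℝ)| / x * besselI k.natAbs x =
      (besselI (k + 1).natAbs x + besselI (k - 1).natAbs x) / 2 := by
  have key : ∀ j : ℕ, besselI (j + 2) x + ((j + 1 : ℕ) : ℝ) / x * besselI (j + 1) x =
      (besselI (j + 2) x + besselI j x) / 2 := by
    intro j
    have := besselI_recurrence hx j
    rw [mul_div_assoc, mul_assoc] at this
    push_cast
    linarith
  obtain ⟨j, rfl | rfl⟩ := k.eq_nat_or_neg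
  · rcases j with _ | j
    · simp
    · have h1 : (((j + 1 : ℕ) : ℤ) + 1).natAbs = j + 2 := by omega
      have h2 : (((j + 1 : ℕ) : ℤ) - 1).natAbs = j := by omega
      rw [h1, h2, Int.natAbs_natCast, ← key j]
      simp only [Int.cast_natCast, Nat.abs_cast]
  · rcases j with _ | j
    · simp
    · have h1 : (-((j + 1 : ℕ) : ℤ) + 1).natAbs = j := by omega
      have h2 : (-((j + 1 : ℕ) : ℤ) - 1).natAbs = j + 2 := by omega
      rw [h1, h2, Int.natAbs_neg, Int.natAbs_natCast, add_comm (besselI j x), ← key j]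
      simp only [Int.cast_neg, Int.cast_natCast, abs_neg, Nat.abs_cast]

/-! ### Sums of independent signs. -/

section Signs

variable {Ω : Type*} [MeasurableSpace Ω] {P : Measure Ω} [IsProbabilityMeasure P] {ε : ℕ → Ω → ℤ}

lemma ae_sign_eq (hm : ∀ i, Measurable (ε i)) (hp : ∀ i, P {ω | ε i ω = 1} = 1 / 2)
    (hn : ∀ i, P {ω | ε i ω = -1} = 1 / 2) (i : ℕ) : ∀ᵐ ω ∂P, ε i ω = 1 ∨ ε i ω = -1 := by
  have h1 : MeasurableSet {ω | ε i ω = 1} := measurableSet_eq_fun (hm i) measurable_const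
  have h2 : MeasurableSet {ω | ε i ω = -1} := measurableSet_eq_fun (hm i) measurable_const
  have h : P ({ω | ε i ω = 1} ∪ {ω | ε i ω = -1}) = 1 := by
    rw [measure_union _ h2, hp, hn, one_div, ENNReal.inv_two_add_inv_two]
    rw [Set.disjoint_left]
    intro ω h1 h2
    simp only [Set.mem_ofPred_eq] at h1 h2
    omega
  have := (prob_compl_eq_zero_iff (h1.union h2)).mpr h
  rw [ae_iff]
  convert! this using 2

lemma measureReal_sum_signs (hm : ∀ i, Measurable (ε i)) (hp : ∀ i, P {ω | ε i ω = 1} = 1 / 2)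
    (hn : ∀ i, P {ω | ε i ω = -1} = 1 / 2) (hind : iIndepFun ε P) (s : Finset ℕ) (k : ℤ) :
    P.real {ω | ∑ i ∈ s, ε i ω = k} = walkProb s.card k := by
  induction s using Finset.induction_on generalizing k with
  | empty =>
    by_cases hk : k = 0
    · simp [walkProb, hk]
    · simp [walkProb, hk, Ne.symm hk]
  | insert a s ha ih =>
    have hms : Measurable (fun ω => ∑ i ∈ s, ε i ω) := Finset.measurable_sum _ fun i _ => hm i
    have hI : IndepFun (∑ i ∈ s, ε i) (ε a) P := hind.indepFun_finsetSum_of_notMem hm ha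
    have hsplit : {ω | ∑ i ∈ insert a s, ε i ω = k} =ᵐ[P]
        (({ω | ∑ i ∈ s, ε i ω = k - 1} ∩ {ω | ε a ω = 1}) ∪
          ({ω | ∑ i ∈ s, ε i ω = k + 1} ∩ {ω | ε a ω = -1}) : Set Ω) := by
      filter_upwards [ae_sign_eq hm hp hn a] with ω hω
      apply propext
      change (∑ i ∈ insert a s, ε i ω = k) ↔ ((∑ i ∈ s, ε i ω = k - 1 ∧ ε a ω = 1) ∨
        (∑ i ∈ s, ε i ω = k + 1 ∧ ε a ω = -1))
      rw [Finset.sum_insert ha]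
      omega
    have hprod : ∀ c d : ℤ, P.real ({ω | ∑ i ∈ s, ε i ω = c} ∩ {ω | ε a ω = d}) =
        walkProb s.card c * P.real {ω | ε a ω = d} := by
      intro c d
      rw [← ih c, measureReal_def, measureReal_def, measureReal_def, ← ENNReal.toReal_mul]
      congr 1
      have := hI.measure_inter_preimage_eq_mul {c} {d} (measurableSet_singleton c)
        (measurableSet_singleton d)
      convert! this using 3 <;> ext ω <;> simp
    rw [measureReal_congr hsplit, measureReal_union, hprod, hprod, Finset.card_insert_of_notMem ha]
    · simp only [walkProb, measureReal_def, hp, hn]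
      norm_num
      ring
    · rw [Set.disjoint_left]
      rintro ω ⟨_, h1⟩ ⟨_, h2⟩
      simp only [Set.mem_ofPred_eq] at h1 h2
      omega
    · refine MeasurableSet.inter ?_ (measurableSet_eq_fun (hm a) measurable_const)
      have := measurableSet_eq_fun hms (measurable_const (a := k + 1))
      exact this

/-- Disjoint blocks of signs are independent. The deterministic block ends `a j` stand for the
values of the Poisson process at the grid times, on which one conditions later. -/
lemma measureReal_sum_sign_blocks (hm : ∀ i, Measurable (ε i))
    (hp : ∀ i, P {ω | ε i ω = 1} = 1 / 2) (hn : ∀ i, P {ω | ε i ω = -1} = 1 / 2)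
    (hind : iIndepFun ε P) {a : ℕ → ℕ} (ha : Monotone a) (y : ℕ → ℤ) (n : ℕ) :
    P.real {ω | ∀ j < n, ∑ i ∈ Finset.Ico (a j) (a (j + 1)), ε i ω = y j} =
      ∏ j ∈ Finset.range n, walkProb (a (j + 1) - a j) (y j) := by
  induction n with
  | zero => simp
  | succ n ih =>
    have hI := hind.indepFun_finset (Finset.range (a n)) (Finset.Ico (a n) (a (n + 1)))
      (by rw [Finset.disjoint_left]; intro i; simp; omega) hm
    -- The value `0` outside the range is never read: every block with `j < n` ends at or before `a
    -- n`.
    let A : Set ((Finset.range (a n)) → ℤ) :=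
      {x | ∀ j < n, ∑ i ∈ Finset.Ico (a j) (a (j + 1)),
        (if h : i ∈ Finset.range (a n) then x ⟨i, h⟩ else 0) = y j}
    let B : Set ((Finset.Ico (a n) (a (n + 1))) → ℤ) := {x | ∑ i, x i = y n}
    have hA : {ω | ∀ j < n, ∑ i ∈ Finset.Ico (a j) (a (j + 1)), ε i ω = y j} =
        (fun ω (i : Finset.range (a n)) => ε i ω) ⁻¹' A := by
      ext ω
      simp only [A, Set.mem_ofPred_eq, Set.mem_preimage]
      refine forall₂_congr fun j hj => ?_
      rw [Finset.sum_congr rfl fun i hi => ?_]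
      have := ha (show j + 1 ≤ n from hj)
      rw [Finset.mem_Ico] at hi
      rw [dif_pos (Finset.mem_range.mpr (by omega))]
    have hB : {ω | ∑ i ∈ Finset.Ico (a n) (a (n + 1)), ε i ω = y n} =
        (fun ω (i : Finset.Ico (a n) (a (n + 1))) => ε i ω) ⁻¹' B := by
      ext ω
      simp only [B, Set.mem_ofPred_eq, Set.mem_preimage]
      rw [← Finset.sum_coe_sort]
    have := hI.measure_inter_preimage_eq_mul A B (Set.to_countable _).measurableSet
      (Set.to_countable _).measurableSet
    rw [← hA, ← hB] at this
    rw [Finset.prod_range_succ, ← ih, ← Nat.card_Ico, ← measureReal_sum_signs hm hp hn hind,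
      measureReal_def, measureReal_def, measureReal_def, ← ENNReal.toReal_mul, ← this]
    congr 2
    ext ω
    simp only [Set.mem_ofPred_eq, Set.mem_inter_iff, Nat.lt_succ_iff_lt_or_eq, or_imp, forall_and,
      forall_eq]

end Signs

/-! ### Law of the discrete observation. -/

/-- The time grid `0, Δ, 2Δ, …`. -/
noncomputable def grid (Δ : ℝ) (i : ℕ) : ℝ≥0 := ((i : ℝ) * Δ).toNNReal

lemma grid_zero (Δ : ℝ) : grid Δ 0 = 0 := by simp [grid]

lemma grid_monotone {Δ : ℝ} (hΔ : 0 ≤ Δ) : Monotone (grid Δ) := fun i j hij => by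
  unfold grid
  gcongr

lemma grid_succ_sub {Δ : ℝ} (hΔ : 0 ≤ Δ) (i : ℕ) : grid Δ (i + 1) - grid Δ i = Δ.toNNReal := by
  unfold grid
  rw [show ((i + 1 : ℕ) : ℝ) * Δ = i * Δ + Δ by push_cast; ring,
    Real.toNNReal_add (by positivity) hΔ, add_tsub_cancel_left]

section Model

variable {Ω : Type*} [MeasurableSpace Ω] {P : Measure Ω} {ϑ : ℝ} {N : ℝ≥0 → Ω → ℕ}
  {ε : ℕ → Ω → ℤ}

lemma measurable_compound (hN : ∀ t, Measurable (N t)) (hε : ∀ i, Measurable (ε i)) (t : ℝ≥0) :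
    Measurable (compound N ε t) := by
  have : Measurable (fun p : ℕ × Ω => ∑ i ∈ Finset.range p.1, ε i p.2) :=
    measurable_from_prod_countable_right fun n =>
      Finset.measurable_sum (Finset.range n) fun i _ => hε i
  exact this.comp ((hN t).prodMk measurable_id)

/-- The truncated difference in `ℕ` is `Int.toNat` of the integer difference, so independence and
the Poisson law transfer from `ℤ` without using monotone paths. -/
lemma IsPoissonProcess.map_increments (h : IsPoissonProcess P ϑ N) {Δ : ℝ} (hΔ : 0 ≤ Δ) (n : ℕ) :
    P.map (fun ω (j : Fin n) => N (grid Δ (j + 1)) ω - N (grid Δ j) ω) =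
      Measure.pi fun _ => poissonMeasure (ϑ.toNNReal * Δ.toNNReal) := by
  have hind := (h.indep_increments.nat (grid_monotone hΔ)).precomp (Fin.val_injective (n := n))
  have hind' := hind.comp (fun _ => Int.toNat) (fun _ => measurable_from_top)
  have heq : ∀ j : Fin n, (Int.toNat ∘ (fun ω => (N (grid Δ (j + 1)) ω : ℤ) - N (grid Δ j) ω)) =
      fun ω => N (grid Δ (j + 1)) ω - N (grid Δ j) ω := by
    intro j; ext ω; simp
  have hmeas : ∀ j : Fin n, Measurable (fun ω => N (grid Δ (j + 1)) ω - N (grid Δ j) ω) :=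
    fun j => (h.measurable _).sub (h.measurable _)
  have hpi := iIndepFun.map_fun_eq_pi_map
    (f := fun (j : Fin n) ω => N (grid Δ (j + 1)) ω - N (grid Δ j) ω)
    (fun j => (hmeas j).aemeasurable) (by convert! hind' using 2 with j; exact (heq j).symm)
  rw [hpi]
  congr 1
  ext1 j
  have hl := h.increment_law _ _ (grid_monotone hΔ (Nat.le_succ j))
  rw [Nat.succ_eq_add_one, grid_succ_sub hΔ] at hl
  have := congrArg (Measure.map Int.toNat) hl.map_eq
  rw [Measure.map_map measurable_from_top measurable_from_top,
    AEMeasurable.map_map_of_aemeasurable measurable_from_top.aemeasurable hl.aemeasurable,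
    heq j] at this
  rw [this]
  convert! Measure.map_id using 2

/-- Conditionally on the jump counts `m`, the increments of the compound process are sums over
consecutive blocks of signs of lengths `m j`. Their joint probability is a product of walk
probabilities; integrating over independent Poisson counts factorises it into Skellam probabilities.
-/
theorem IsModel.measureReal_increments (h : IsModel P ϑ N ε) (hϑ : 0 < ϑ) {Δ : ℝ} (hΔ : 0 < Δ)
    {n : ℕ} (y : Fin n → ℤ) :
    P.real {ω | ∀ j : Fin n, compound N ε (grid Δ (j + 1)) ω - compound N ε (grid Δ j) ω = y j} =
      ∏ j, skellamProb (ϑ * Δ) (y j) := by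
  have := h.isProbabilityMeasure
  have hN := h.poisson
  set M : Ω → Fin n → ℕ := fun ω j => N (grid Δ (j + 1)) ω - N (grid Δ j) ω with hM
  have hMm : Measurable M := measurable_pi_lambda _ fun j => (hN.measurable _).sub (hN.measurable _)
  have hEm : Measurable (fun ω i => ε i ω) := measurable_pi_lambda _ h.measurable_sign
  have hI : IndepFun (fun ω i => ε i ω) M P := by
    have := h.indep.comp (φ := id)
      (ψ := fun (x : ℝ≥0 → ℕ) (j : Fin n) => x (grid Δ (j + 1)) - x (grid Δ j))
      measurable_id (measurable_pi_lambda _ fun j => (measurable_pi_apply _).sub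
        (measurable_pi_apply _))
    exact this
  -- Partial sums of `m`, indexed by all of `ℕ` to fit the block lemma; they are constant from index
  -- `n` on.
  let a : (Fin n → ℕ) → ℕ → ℕ := fun m j => ∑ i : Fin n, if (i : ℕ) < j then m i else 0
  have ha0 : ∀ m, a m 0 = 0 := fun m => by simp [a]
  have hasucc : ∀ m (j : Fin n), a m (j + 1) = a m j + m j := by
    intro m j
    simp only [a]
    rw [← Finset.sum_ite_eq' Finset.univ j m |>.trans (if_pos (Finset.mem_univ j)),
      ← Finset.sum_add_distrib]
    refine Finset.sum_congr rfl fun i _ => ?_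
    rcases lt_trichotomy (i : ℕ) j with hij | hij | hij
    · rw [if_pos (by omega), if_pos hij, if_neg (by rintro rfl; omega), add_zero]
    · rw [if_pos (by omega), if_neg (by omega), if_pos (Fin.ext hij), zero_add]
    · rw [if_neg (by omega), if_neg (by omega), if_neg (by rintro rfl; omega), add_zero]
  have hamono : ∀ m, Monotone (a m) := by
    intro m j k hjk
    refine Finset.sum_le_sum fun i _ => ?_
    split_ifs <;> omega
  let D : (Fin n → ℕ) → Set (ℕ → ℤ) := fun m =>
    {e | ∀ j : Fin n, ∑ i ∈ Finset.Ico (a m j) (a m (j + 1)), e i = y j}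
  have hDm : ∀ m, MeasurableSet (D m) := by
    intro m
    have : D m = ⋂ j : Fin n, {e | ∑ i ∈ Finset.Ico (a m j) (a m (j + 1)), e i = y j} := by
      ext e; simp [D]
    rw [this]
    refine MeasurableSet.iInter fun j => measurableSet_eq_fun ?_ measurable_const
    exact Finset.measurable_sum _ fun i _ => measurable_pi_apply i
  let DD : Set ((ℕ → ℤ) × (Fin n → ℕ)) := {p | p.1 ∈ D p.2}
  have hDDm : MeasurableSet DD := by
    have : DD = ⋃ m, D m ×ˢ {m} := by
      ext ⟨e, m⟩
      simp [DD]
    rw [this]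
    exact MeasurableSet.iUnion fun m => (hDm m).prod (measurableSet_singleton m)
  have hset : {ω | ∀ j : Fin n,
      compound N ε (grid Δ (j + 1)) ω - compound N ε (grid Δ j) ω = y j} =ᵐ[P]
      ((fun ω => ((fun i => ε i ω), M ω)) ⁻¹' DD : Set Ω) := by
    -- Monotone paths started at `0` make the truncated differences exact, so the partial sums of `M
    -- ω` recover `N` on the grid.
    filter_upwards [hN.mono, hN.start_zero] with ω hmono h0
    apply propext
    have hval : ∀ j ≤ n, N (grid Δ j) ω = a (M ω) j := by
      intro j hj
      induction j with
      | zero => rw [grid_zero, ha0, h0]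
      | succ j ih =>
        have h1 := hasucc (M ω) ⟨j, hj⟩
        have h2 := hmono (grid_monotone hΔ.le (Nat.le_succ j))
        simp only [Nat.succ_eq_add_one] at h2
        simp only at h1
        rw [h1, ← ih (by omega)]
        simp only [hM]
        omega
    change (∀ j : Fin n, compound N ε (grid Δ (j + 1)) ω - compound N ε (grid Δ j) ω = y j) ↔
      ∀ j : Fin n, ∑ i ∈ Finset.Ico (a (M ω) j) (a (M ω) (j + 1)), ε i ω = y j
    refine forall_congr' fun j => ?_
    rw [Finset.sum_Ico_eq_sub _ (hamono _ (Nat.le_succ _)), ← hval _ j.2.le,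
      ← hval _ (show (j : ℕ) + 1 ≤ n from j.2)]
    rfl
  have hDprob : ∀ m, (P.map (fun ω i => ε i ω)) (D m) =
      ENNReal.ofReal (∏ j, walkProb (m j) (y j)) := by
    intro m
    rw [Measure.map_apply hEm (hDm m)]
    have := measureReal_sum_sign_blocks h.measurable_sign h.sign_pos h.sign_neg h.sign_indep
      (hamono m) (fun j => if hj : j < n then y ⟨j, hj⟩ else 0) n
    rw [Finset.prod_range] at this
    have h2 : ∏ j : Fin n, walkProb (a m (j + 1) - a m j)
        (if hj : (j : ℕ) < n then y ⟨j, hj⟩ else 0) = ∏ j, walkProb (m j) (y j) := by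
      refine Finset.prod_congr rfl fun j _ => ?_
      rw [dif_pos j.2, hasucc, Nat.add_sub_cancel_left]
    rw [← h2, ← this, ofReal_measureReal]
    congr 1
    ext ω
    simp only [D, Set.mem_preimage, Set.mem_ofPred_eq]
    refine ⟨fun H j hj => ?_, fun H j => ?_⟩
    · rw [dif_pos hj]; exact H ⟨j, hj⟩
    · have := H j j.2
      rwa [dif_pos j.2] at this
  have hmap := (indepFun_iff_map_prod_eq_prod_map_map hEm.aemeasurable hMm.aemeasurable).mp hI
  have hlaw := hN.map_increments hΔ.le n
  change P.map M = _ at hlaw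
  rw [measureReal_congr hset, measureReal_def, ← Measure.map_apply (hEm.prodMk hMm) hDDm, hmap,
    Measure.prod_apply_symm hDDm]
  have : ∀ m, (fun e => (e, m)) ⁻¹' DD = D m := fun m => rfl
  simp_rw [this, hDprob, hlaw]
  rw [← ofReal_integral_eq_lintegral_ofReal, ENNReal.toReal_ofReal,
    integral_fintype_prod_eq_prod (f := fun j k => walkProb k (y j))]
  · refine Finset.prod_congr rfl fun j _ => ?_
    rw [integral_poissonMeasure, ← tsum_poisson_mul_walkProb]
    simp [Real.coe_toNNReal _ hϑ.le, Real.coe_toNNReal _ hΔ.le]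
  · exact integral_nonneg fun m => Finset.prod_nonneg fun j _ => walkProb_nonneg _ _
  · refine Integrable.of_bound (C := 1) (measurable_of_countable _).aestronglyMeasurable ?_
    refine ae_of_all _ fun m => ?_
    rw [Real.norm_eq_abs, abs_of_nonneg (Finset.prod_nonneg fun j _ => walkProb_nonneg _ _)]
    exact Finset.prod_le_one (fun j _ => walkProb_nonneg _ _) fun j _ => walkProb_le_one _ _
  · exact ae_of_all _ fun m => Finset.prod_nonneg fun j _ => walkProb_nonneg _ _

/-- The increments of a finite sequence started at `0`. -/
def increments {n : ℕ} (z : Fin n → ℤ) (j : Fin n) : ℤ :=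
  z j - if (j : ℕ) = 0 then 0 else z ⟨j - 1, by omega⟩

lemma increments_injective (n : ℕ) : Function.Injective (increments (n := n)) := by
  intro z z' h
  have : ∀ k (hk : k < n), z ⟨k, hk⟩ = z' ⟨k, hk⟩ := by
    intro k
    induction k with
    | zero => intro hk; simpa [increments] using congrFun h ⟨0, hk⟩
    | succ k ih =>
      intro hk
      have := congrFun h ⟨k + 1, hk⟩
      simp only [increments, Nat.succ_ne_zero, if_false, Nat.add_sub_cancel, ih (by omega)] at this
      omega
  ext j
  exact this j j.2

lemma IsModel.ae_compound_zero (h : IsModel P ϑ N ε) : ∀ᵐ ω ∂P, compound N ε 0 ω = 0 := by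
  filter_upwards [h.poisson.start_zero] with ω hω
  simp [compound, hω]

lemma IsModel.measureReal_compound (h : IsModel P ϑ N ε) (hϑ : 0 < ϑ) {Δ : ℝ} (hΔ : 0 < Δ)
    (k : ℤ) : (P.map (compound N ε Δ.toNNReal)).real {k} = skellamProb (ϑ * Δ) k := by
  have := h.measureReal_increments hϑ hΔ (n := 1) (fun _ => k)
  rw [Fin.prod_univ_one] at this
  rw [← this, map_measureReal_apply
    (measurable_compound h.poisson.measurable h.measurable_sign _) (measurableSet_singleton k)]
  refine measureReal_congr ?_
  filter_upwards [h.ae_compound_zero] with ω hω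
  apply propext
  change compound N ε Δ.toNNReal ω = k ↔
    ∀ j : Fin 1, compound N ε (grid Δ (j + 1)) ω - compound N ε (grid Δ j) ω = k
  rw [Fin.forall_fin_one]
  simp only [Fin.val_zero, grid_zero, hω, sub_zero]
  simp [grid]

lemma measurable_observation {X : ℝ≥0 → Ω → ℤ} (hX : ∀ t, Measurable (X t)) (T Δ : ℝ) :
    Measurable (fun ω (i : Fin ⌊T / Δ⌋₊) => X ((((i : ℕ) + 1 : ℝ) * Δ).toNNReal) ω) :=
  measurable_pi_lambda _ fun _ => hX _

/-- Almost surely `X 0 = 0`, so differencing the observed vector, with `0` prepended, gives the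
process increments. Both measures live on a countable space and are compared on singletons. -/
theorem IsModel.map_increments_observationLaw (h : IsModel P ϑ N ε) (hϑ : 0 < ϑ) (T : ℝ) {Δ : ℝ}
    (hΔ : 0 < Δ) : (observationLaw P (compound N ε) T Δ).map increments =
      Measure.pi fun _ => P.map (compound N ε Δ.toNNReal) := by
  have := h.isProbabilityMeasure
  have hX := measurable_compound h.poisson.measurable h.measurable_sign
  have : ∀ t, IsProbabilityMeasure (P.map (compound N ε t)) := fun t =>
    Measure.isProbabilityMeasure_map (hX t).aemeasurable
  have hobs := measurable_observation hX T Δ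
  refine Measure.ext_of_singleton fun y => ?_
  rw [Measure.pi_singleton, Measure.map_apply (measurable_of_countable _)
    (measurableSet_singleton y), observationLaw, Measure.map_apply hobs
    (Set.to_countable _).measurableSet]
  rw [← ENNReal.toReal_eq_toReal_iff' (measure_ne_top _ _)
    (ENNReal.prod_ne_top fun j _ => measure_ne_top _ _), ENNReal.toReal_prod]
  simp_rw [← measureReal_def, h.measureReal_compound hϑ hΔ]
  rw [← h.measureReal_increments hϑ hΔ]
  refine measureReal_congr ?_
  filter_upwards [h.ae_compound_zero] with ω hω
  apply propext
  change increments _ = y ↔ ∀ j : Fin _, compound N ε (grid Δ (j + 1)) ω -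
    compound N ε (grid Δ j) ω = y j
  rw [funext_iff]
  refine forall_congr' fun j => ?_
  have : (if (j : ℕ) = 0 then (0 : ℤ) else
      compound N ε (((((j : ℕ) - 1 : ℕ) : ℝ) + 1) * Δ).toNNReal ω) =
      compound N ε (grid Δ j) ω := by
    split_ifs with hj
    · rw [hj, grid_zero, hω]
    · rw [grid]
      congr 3
      exact_mod_cast Nat.sub_add_cancel (by omega)
  simp only [increments, this]
  simp [grid]

lemma IsModel.measureReal_observationLaw_singleton (h : IsModel P ϑ N ε) (hϑ : 0 < ϑ) (T : ℝ)
    {Δ : ℝ} (hΔ : 0 < Δ) (z : Fin ⌊T / Δ⌋₊ → ℤ) :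
    (observationLaw P (compound N ε) T Δ).real {z} =
      ∏ j, skellamProb (ϑ * Δ) (increments z j) := by
  have := h.isProbabilityMeasure
  have hX := measurable_compound h.poisson.measurable h.measurable_sign
  have : ∀ t, IsProbabilityMeasure (P.map (compound N ε t)) := fun t =>
    Measure.isProbabilityMeasure_map (hX t).aemeasurable
  have h1 : ({z} : Set (Fin ⌊T / Δ⌋₊ → ℤ)) = increments ⁻¹' {increments z} := by
    ext x
    simp [(increments_injective _).eq_iff]
  rw [h1, ← map_measureReal_apply (measurable_of_countable _) (measurableSet_singleton _),
    h.map_increments_observationLaw hϑ T hΔ, measureReal_def, Measure.pi_singleton,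
    ENNReal.toReal_prod]
  simp_rw [← measureReal_def, h.measureReal_compound hϑ hΔ]

end Model

/-! ### Skellam expectations at small intensity. -/

section SmallIntensity

variable {E : Type*} [NormedAddCommGroup E]

lemma summable_int_pow_div_factorial (b : ℝ) :
    Summable fun k : ℤ => b ^ k.natAbs / (k.natAbs.factorial : ℝ) :=
  .of_nat_of_neg (by simpa using Real.summable_pow_div_factorial b)
    (by simpa using Real.summable_pow_div_factorial b)

lemma exp_two_mul_natAbs (k : ℤ) : Real.exp (2 * k.natAbs) = Real.exp 2 ^ k.natAbs := by
  rw [← Real.exp_nat_mul]; ring_nf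

lemma summable_skellamProb_mul {lam : ℝ} (h : 0 < lam) {f : ℤ → E} {C : ℝ}
    (hf : ∀ k, ‖f k‖ ≤ C * Real.exp (2 * k.natAbs)) :
    Summable fun k => skellamProb lam k * ‖f k‖ := by
  refine Summable.of_nonneg_of_le
    (fun k => mul_nonneg (skellamProb_pos h k).le (norm_nonneg _)) (fun k => ?_)
    ((summable_int_pow_div_factorial (lam / 2 * Real.exp 2)).mul_left
      (Real.exp ((lam / 2) ^ 2 - lam) * C))
  calc _ ≤ (Real.exp ((lam / 2) ^ 2 - lam) * ((lam / 2) ^ k.natAbs / k.natAbs.factorial)) *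
        (C * Real.exp (2 * k.natAbs)) := by
        gcongr
        · exact skellamProb_le h k
        · exact hf k
    _ = _ := by rw [exp_two_mul_natAbs, mul_pow]; ring

lemma integrable_of_le_exp {lam : ℝ} (h : 0 < lam) {κ : Measure ℤ} [IsFiniteMeasure κ]
    (hκ : ∀ k, κ.real {k} = skellamProb lam k) {f : ℤ → E} {C : ℝ}
    (hf : ∀ k, ‖f k‖ ≤ C * Real.exp (2 * k.natAbs)) : Integrable f κ := by
  rw [← Measure.sum_smul_dirac κ, integrable_sum_dirac_iff (fun k => measure_ne_top _ _)]
  simp_rw [← measureReal_def, hκ]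
  exact summable_skellamProb_mul h hf

lemma tendsto_besselSeries_zero {ι : Type*} {l : Filter ι} {z : ι → ℝ} (hz : Tendsto z l (𝓝 0))
    (k : ℕ) : Tendsto (fun i => besselSeries k (z i)) l (𝓝 (1 / (k.factorial : ℝ))) := by
  have h := (hasDerivAt_besselSeries k 0).continuousAt.tendsto.comp hz
  have h0 : besselSeries k 0 = 1 / (k.factorial : ℝ) := by
    rw [besselSeries_eq_add]; simp
  rwa [h0] at h

/-- To first order the law is `λ / 2` at each of `±1`, and `0` carries nearly all the rest. Hence
`λ⁻¹ ∫ f` tends to the common limit at `±1`, provided `f 0 = o(λ)`. The growth allowance `exp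
(2|k|)` covers squares of quantities bounded by a multiple of `exp |k|`, such as the score. -/
theorem tendsto_integral_skellam [NormedSpace ℝ E] [CompleteSpace E] {ι : Type*} {l : Filter ι}
    [l.IsCountablyGenerated] {lam : ι → ℝ} {κ : ι → Measure ℤ} [∀ i, IsFiniteMeasure (κ i)]
    (hlam : Tendsto lam l (𝓝[>] 0)) (hκ : ∀ᶠ i in l, ∀ k, (κ i).real {k} = skellamProb (lam i) k)
    {f : ι → ℤ → E} {C : ℝ} {a : E}
    (hf : ∀ᶠ i in l, ∀ k, ‖f i k‖ ≤ C * Real.exp (2 * k.natAbs))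
    (h0 : Tendsto (fun i => (lam i)⁻¹ • f i 0) l (𝓝 0))
    (h1 : Tendsto (fun i => f i 1) l (𝓝 a)) (h2 : Tendsto (fun i => f i (-1)) l (𝓝 a)) :
    Tendsto (fun i => (lam i)⁻¹ • ∫ k, f i k ∂(κ i)) l (𝓝 a) := by
  have hpos : ∀ᶠ i in l, 0 < lam i := hlam.eventually self_mem_nhdsWithin
  have hlam0 : Tendsto lam l (𝓝 0) := hlam.mono_right nhdsWithin_le_nhds
  have hone : ∀ᶠ i in l, lam i < 1 := hlam0.eventually (gt_mem_nhds one_pos)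
  -- Summable majorant: for `λ < 1` and `k ≠ 0`, `λ⁻¹ (λ / 2)^|k| ≤ (1 / 2)^|k|`, and the factorial
  -- absorbs the factor `exp (2|k|)`.
  let b : ℤ → ℝ := fun k => |C| * ((1 / 2 * Real.exp 2) ^ k.natAbs / k.natAbs.factorial)
  let g : ℤ → E := fun k => if k = 1 then (1 / 2 : ℝ) • a else if k = -1 then (1 / 2 : ℝ) • a else 0
  have hg : ∑' k, g k = a := by
    rw [tsum_eq_sum (s := {1, -1})]
    · rw [Finset.sum_pair (by norm_num)]
      simp only [g, if_pos, if_neg (show ¬ (-1 : ℤ) = 1 by norm_num)]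
      rw [← add_smul]; norm_num
    · intro k hk
      simp only [Finset.mem_insert, Finset.mem_singleton, not_or] at hk
      simp [g, hk.1, hk.2]
  have hlam2 : Tendsto (fun i => (lam i / 2) ^ 2) l (𝓝 0) := by
    simpa using (hlam0.div_const 2).pow 2
  have hexp : Tendsto (fun i => Real.exp (-lam i)) l (𝓝 1) := by
    have := (Real.continuous_exp.tendsto (-0)).comp hlam0.neg
    rwa [neg_zero, Real.exp_zero] at this
  have hside : ∀ k : ℤ, k.natAbs = 1 → Tendsto (fun i => f i k) l (𝓝 a) →
      Tendsto (fun i => (lam i)⁻¹ • (skellamProb (lam i) k • f i k)) l (𝓝 ((1 / 2 : ℝ) • a)) := by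
    intro k hk hfk
    have : Tendsto (fun i => (Real.exp (-lam i) * (1 / 2 * besselSeries 1 ((lam i / 2) ^ 2))) •
        f i k) l (𝓝 ((1 * (1 / 2 * (1 / (Nat.factorial 1 : ℝ)))) • a)) :=
      (hexp.mul ((tendsto_besselSeries_zero hlam2 1).const_mul _)).smul hfk
    simp only [Nat.factorial_one, Nat.cast_one, one_mul, div_one, mul_one] at this
    refine this.congr' ?_
    filter_upwards [hpos] with i hi
    rw [smul_smul, skellamProb_eq, hk]
    congr 1
    field_simp
  have hterm : ∀ k, Tendsto (fun i => (lam i)⁻¹ • (skellamProb (lam i) k • f i k)) l (𝓝 (g k)) := by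
    intro k
    by_cases hk1 : k = 1
    · subst hk1; simpa [g] using hside 1 rfl h1
    by_cases hk2 : k = -1
    · subst hk2; simpa [g] using hside (-1) rfl h2
    simp only [g, hk1, hk2, if_false]
    by_cases hk0 : k = 0
    · subst hk0
      have : Tendsto (fun i => (Real.exp (-lam i) * besselSeries 0 ((lam i / 2) ^ 2)) •
          ((lam i)⁻¹ • f i 0)) l (𝓝 ((1 * (1 / (Nat.factorial 0 : ℝ))) • (0 : E))) :=
        (hexp.mul (tendsto_besselSeries_zero hlam2 0)).smul h0
      rw [smul_zero] at this
      refine this.congr fun i => ?_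
      rw [smul_smul, smul_smul, skellamProb_eq]
      congr 1
      simp
      ring
    -- For `|k| ≥ 2` the probability is at most `λ²`, so one power of `λ` survives the
    -- normalisation.
    · obtain ⟨j, hj⟩ : ∃ j, k.natAbs = j + 2 := ⟨k.natAbs - 2, by omega⟩
      have hmaj : Tendsto (fun i => lam i * (C * Real.exp (2 * k.natAbs))) l (𝓝 0) := by
        simpa using hlam0.mul_const (C * Real.exp (2 * k.natAbs))
      refine squeeze_zero_norm' ?_ hmaj
      filter_upwards [hpos, hone, hf] with i hi hi1 hfi
      rw [norm_smul, norm_smul, norm_inv, Real.norm_of_nonneg hi.le,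
        Real.norm_of_nonneg (skellamProb_pos hi k).le, ← mul_assoc]
      have hs := skellamProb_le hi k
      have he : Real.exp ((lam i / 2) ^ 2 - lam i) ≤ 1 := Real.exp_le_one_iff.mpr (by nlinarith)
      have hp : (lam i / 2) ^ k.natAbs / k.natAbs.factorial ≤ lam i ^ 2 := by
        rw [hj]
        have hfac : (1:ℝ) ≤ (j + 2).factorial := by exact_mod_cast Nat.factorial_pos _
        calc _ ≤ (lam i / 2) ^ (j + 2) := div_le_self (by positivity) hfac
          _ ≤ lam i ^ (j + 2) := by gcongr; linarith
          _ ≤ lam i ^ 2 := pow_le_pow_of_le_one hi.le hi1.le (by omega)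
      have hs2 : skellamProb (lam i) k ≤ lam i ^ 2 := by
        refine hs.trans ?_
        calc _ ≤ 1 * lam i ^ 2 := by gcongr
          _ = _ := one_mul _
      have : (lam i)⁻¹ * skellamProb (lam i) k ≤ lam i := by
        rw [inv_mul_le_iff₀ hi]; nlinarith
      exact mul_le_mul this (hfi k) (norm_nonneg _) hi.le
  have h0b : ∀ᶠ i in l, ‖(lam i)⁻¹ • f i 0‖ ≤ 1 := by
    have := h0.norm
    rw [norm_zero] at this
    filter_upwards [this.eventually (gt_mem_nhds one_pos)] with i hi using hi.le
  -- The extra unit at `k = 0` dominates `λ⁻¹ f 0`, which is eventually at most `1` in norm.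
  have hdom : ∀ᶠ i in l, ∀ k, ‖(lam i)⁻¹ • (skellamProb (lam i) k • f i k)‖ ≤
      b k + if k = 0 then 1 else 0 := by
    filter_upwards [hpos, hone, hf, h0b] with i hi hi1 hfi hi0 k
    have he : Real.exp ((lam i / 2) ^ 2 - lam i) ≤ 1 := Real.exp_le_one_iff.mpr (by nlinarith)
    have hb0 : 0 ≤ b k := by positivity
    have hs := skellamProb_le hi k
    have hsp := skellamProb_pos hi k
    by_cases hk : k = 0
    · subst hk
      rw [smul_comm, norm_smul, Real.norm_of_nonneg hsp.le, if_pos rfl]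
      have : skellamProb (lam i) 0 ≤ 1 := by refine hs.trans ?_; simpa using he
      nlinarith [norm_nonneg ((lam i)⁻¹ • f i 0)]
    · rw [if_neg hk, add_zero, norm_smul, norm_smul, norm_inv, Real.norm_of_nonneg hi.le,
        Real.norm_of_nonneg hsp.le, ← mul_assoc]
      obtain ⟨j, hj⟩ : ∃ j, k.natAbs = j + 1 := ⟨k.natAbs - 1, by omega⟩
      have hp : (lam i)⁻¹ * skellamProb (lam i) k ≤ (1 / 2) ^ k.natAbs / k.natAbs.factorial := by
        rw [inv_mul_le_iff₀ hi]
        calc _ ≤ 1 * ((lam i / 2) ^ k.natAbs / k.natAbs.factorial) := by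
              refine hs.trans ?_
              gcongr
          _ = (1 / 2) ^ k.natAbs / k.natAbs.factorial * lam i ^ (j + 1) := by
              rw [← hj, div_pow, div_pow]; ring
          _ ≤ (1 / 2) ^ k.natAbs / k.natAbs.factorial * lam i := by
              gcongr
              exact pow_le_of_le_one hi.le hi1.le (by omega)
          _ = _ := mul_comm _ _
      calc _ ≤ (1 / 2) ^ k.natAbs / k.natAbs.factorial * (C * Real.exp (2 * k.natAbs)) := by
            gcongr; exact hfi k
        _ ≤ (1 / 2) ^ k.natAbs / k.natAbs.factorial * (|C| * Real.exp (2 * k.natAbs)) := by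
            gcongr; exact le_abs_self C
        _ = b k := by simp only [b]; rw [exp_two_mul_natAbs, mul_pow]; ring
  have hsum : Summable fun k : ℤ => b k + if k = 0 then (1:ℝ) else 0 :=
    ((summable_int_pow_div_factorial _).mul_left _).add (summable_of_ne_finset_zero (s := {0})
      fun k hk => if_neg (by simpa using hk))
  have := tendsto_tsum_of_dominated_convergence hsum hterm hdom
  rw [hg] at this
  refine this.congr' ?_
  filter_upwards [hpos, hκ, hf] with i hi hκi hfi
  rw [integral_countable (integrable_of_le_exp hi hκi hfi), ← tsum_const_smul'' (lam i)⁻¹]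
  simp_rw [hκi]

end SmallIntensity

/-! ### The score and its moments. -/

section Score

/-- The derivative in `ϑ` of the logarithm of `skellamProb (ϑ * Δ) k`. -/
noncomputable def score (Δ ϑ : ℝ) (k : ℤ) : ℝ :=
  Δ * (besselRatio Δ ϑ k + (ϑ * Δ)⁻¹ * |(k : ℝ)| - 1)

variable {ϑ Δ : ℝ}

lemma score_eq (hϑ : 0 < ϑ) (hΔ : 0 < Δ) (k : ℤ) : score Δ ϑ k =
    |(k : ℝ)| / ϑ + Δ * (ϑ * Δ / 2 * besselSlope k.natAbs ((ϑ * Δ / 2) ^ 2) - 1) := by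
  rw [score, besselRatio_eq hϑ hΔ]
  field_simp
  ring

/-- The Bessel slope lies in `[0, 1]`, so the deviation from `|k| / ϑ` is `O(Δ)` uniformly in `k`.
The approximation `|k| / ϑ` amounts to taking `|k|` as the number of jumps. -/
lemma abs_score_sub_le (hϑ : 0 < ϑ) (hΔ : 0 < Δ) (hΔ1 : Δ ≤ 1) (k : ℤ) :
    |score Δ ϑ k - |(k : ℝ)| / ϑ| ≤ Δ * (1 + ϑ) := by
  rw [score_eq hϑ hΔ, add_sub_cancel_left, abs_mul, abs_of_pos hΔ]
  have h0 := besselSlope_nonneg (k := k.natAbs) (sq_nonneg (ϑ * Δ / 2))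
  have h1 := besselSlope_le_one (k := k.natAbs) (sq_nonneg (ϑ * Δ / 2))
  have h2 : ϑ * Δ / 2 * besselSlope k.natAbs ((ϑ * Δ / 2) ^ 2) ≤ ϑ * 1 / 1 * 1 := by
    gcongr
    norm_num
  have h3 : 0 ≤ ϑ * Δ / 2 * besselSlope k.natAbs ((ϑ * Δ / 2) ^ 2) := by positivity
  gcongr
  rw [abs_le]
  constructor <;> linarith

lemma abs_score_le (hϑ : 0 < ϑ) (hΔ : 0 < Δ) (hΔ1 : Δ ≤ 1) (k : ℤ) :
    |score Δ ϑ k| ≤ (1 / ϑ + 1 + ϑ) * Real.exp k.natAbs := by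
  have h := abs_score_sub_le hϑ hΔ hΔ1 k
  have h1 : |score Δ ϑ k| ≤ |score Δ ϑ k - |(k : ℝ)| / ϑ| + |(k : ℝ)| / ϑ := by
    have := abs_add_le (score Δ ϑ k - |(k : ℝ)| / ϑ) (|(k : ℝ)| / ϑ)
    rwa [sub_add_cancel, abs_of_nonneg (a := |(k : ℝ)| / ϑ) (by positivity)] at this
  have h2 := Real.add_one_le_exp (k.natAbs : ℝ)
  rw [Nat.cast_natAbs, Int.cast_abs] at *
  have h3 : Δ * (1 + ϑ) ≤ 1 + ϑ := by nlinarith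
  have h4 : |(k : ℝ)| / ϑ ≤ 1 / ϑ * Real.exp |(k : ℝ)| := by
    rw [div_eq_inv_mul, one_div]; gcongr; linarith
  have h5 : 1 ≤ Real.exp |(k : ℝ)| := Real.one_le_exp (abs_nonneg _)
  nlinarith

lemma norm_score_sq_le (hϑ : 0 < ϑ) (hΔ : 0 < Δ) (hΔ1 : Δ ≤ 1) (k : ℤ) :
    ‖score Δ ϑ k ^ 2‖ ≤ (1 / ϑ + 1 + ϑ) ^ 2 * Real.exp (2 * k.natAbs) := by
  have h := abs_score_le hϑ hΔ hΔ1 k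
  rw [norm_pow, Real.norm_eq_abs, two_mul, Real.exp_add, ← sq, ← mul_pow]
  gcongr

lemma besselI_pos {x : ℝ} (hx : 0 < x) (k : ℕ) : 0 < besselI k x := by
  rw [besselI_eq]
  have := besselSeries_pos (k := k) (sq_nonneg (x / 2))
  positivity

/-- The left side is the `ϑ`-derivative of the probability, and the identity is the forward equation
of the walk: mass leaves `k` and arrives equally from both neighbours. -/
lemma skellamProb_mul_score (hϑ : 0 < ϑ) (hΔ : 0 < Δ) (k : ℤ) :
    skellamProb (ϑ * Δ) k * score Δ ϑ k = Δ * ((skellamProb (ϑ * Δ) (k + 1) +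
      skellamProb (ϑ * Δ) (k - 1)) / 2 - skellamProb (ϑ * Δ) k) := by
  have hI := (besselI_pos (mul_pos hϑ hΔ) k.natAbs).ne'
  have h := besselI_natAbs_recurrence (mul_pos hϑ hΔ) k
  unfold score skellamProb besselRatio
  generalize besselI (k + 1).natAbs (ϑ * Δ) = b1 at *
  generalize besselI (k - 1).natAbs (ϑ * Δ) = b2 at *
  generalize besselI k.natAbs (ϑ * Δ) = b0 at *
  generalize besselI (k.natAbs + 1) (ϑ * Δ) = b3 at *
  generalize |(k : ℝ)| = c at *
  have hb : b0 * (b3 / b0 + (ϑ * Δ)⁻¹ * c) = b3 + c / (ϑ * Δ) * b0 := by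
    field_simp
  linear_combination (Real.exp (-(ϑ * Δ)) * Δ) * (hb + h)

lemma hasSum_discrete_laplacian {p : ℤ → ℝ} (hp : Summable p) :
    HasSum (fun k => (p (k + 1) + p (k - 1)) / 2 - p k) 0 := by
  have e1 : HasSum (fun k => p (k + 1)) (∑' k, p k) :=
    (Equiv.addRight (1:ℤ)).hasSum_iff.mpr hp.hasSum
  have e2 : HasSum (fun k => p (k - 1)) (∑' k, p k) :=
    (Equiv.subRight (1:ℤ)).hasSum_iff.mpr hp.hasSum
  convert! ((e1.add e2).div_const 2).sub hp.hasSum using 1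
  ring

/-- By the forward equation the mean is a sum of a discrete Laplacian over `ℤ`, which vanishes by
translation invariance. -/
lemma integral_score (hϑ : 0 < ϑ) (hΔ : 0 < Δ) {κ : Measure ℤ} [IsFiniteMeasure κ]
    (hκ : ∀ k, κ.real {k} = skellamProb (ϑ * Δ) k) (hint : Integrable (score Δ ϑ) κ) :
    ∫ k, score Δ ϑ k ∂κ = 0 := by
  have hs : Summable (skellamProb (ϑ * Δ)) := by
    have := summable_skellamProb_mul (mul_pos hϑ hΔ) (f := fun _ => (1:ℝ)) (C := 1)
      (fun k => by rw [norm_one, one_mul]; exact Real.one_le_exp (by positivity))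
    simp only [norm_one, mul_one] at this
    exact this
  rw [integral_countable hint]
  calc _ = ∑' k, Δ * ((skellamProb (ϑ * Δ) (k + 1) +
      skellamProb (ϑ * Δ) (k - 1)) / 2 - skellamProb (ϑ * Δ) k) :=
        tsum_congr fun k => by rw [hκ, smul_eq_mul, skellamProb_mul_score hϑ hΔ]
    _ = 0 := by rw [tsum_mul_left, (hasSum_discrete_laplacian hs).tsum_eq, mul_zero]

variable {ι : Type*} {l : Filter ι} {D : ι → ℝ}

lemma tendsto_const_mul_nhdsGT_zero (hϑ : 0 < ϑ) (hD : Tendsto D l (𝓝[>] 0)) :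
    Tendsto (fun i => ϑ * D i) l (𝓝[>] 0) := by
  rw [tendsto_nhdsWithin_iff] at hD ⊢
  refine ⟨by simpa using hD.1.const_mul ϑ, ?_⟩
  filter_upwards [hD.2] with i hi using mul_pos hϑ hi

lemma eventually_pos_and_le_one (hD : Tendsto D l (𝓝[>] 0)) : ∀ᶠ i in l, 0 < D i ∧ D i ≤ 1 := by
  filter_upwards [hD.eventually self_mem_nhdsWithin,
    (hD.mono_right nhdsWithin_le_nhds).eventually (ge_mem_nhds one_pos)] with i h1 h2
  exact ⟨h1, h2⟩

lemma tendsto_score (hϑ : 0 < ϑ) (hD : Tendsto D l (𝓝[>] 0)) (k : ℤ) :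
    Tendsto (fun i => score (D i) ϑ k) l (𝓝 (|(k : ℝ)| / ϑ)) := by
  rw [tendsto_iff_norm_sub_tendsto_zero]
  have : Tendsto (fun i => D i * (1 + ϑ)) l (𝓝 0) := by
    simpa using (hD.mono_right nhdsWithin_le_nhds).mul_const (1 + ϑ)
  refine squeeze_zero' (Eventually.of_forall fun _ => norm_nonneg _) ?_ this
  filter_upwards [eventually_pos_and_le_one hD] with i hi
  exact abs_score_sub_le hϑ hi.1 hi.2 k

lemma tendsto_inv_mul_score_zero_sq (hϑ : 0 < ϑ) (hD : Tendsto D l (𝓝[>] 0)) :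
    Tendsto (fun i => (ϑ * D i)⁻¹ * score (D i) ϑ 0 ^ 2) l (𝓝 0) := by
  have : Tendsto (fun i => ϑ⁻¹ * D i * (1 + ϑ) ^ 2) l (𝓝 0) := by
    simpa using ((hD.mono_right nhdsWithin_le_nhds).const_mul ϑ⁻¹).mul_const ((1 + ϑ) ^ 2)
  refine squeeze_zero' ?_ ?_ this
  · filter_upwards [eventually_pos_and_le_one hD] with i hi
    have := hi.1
    positivity
  · filter_upwards [eventually_pos_and_le_one hD] with i hi
    have h := abs_score_sub_le hϑ hi.1 hi.2 0
    have h0 := hi.1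
    simp only [Int.cast_zero, abs_zero, zero_div, sub_zero] at h
    calc _ ≤ (ϑ * D i)⁻¹ * (D i * (1 + ϑ)) ^ 2 := by
          gcongr _ * ?_
          exact sq_le_sq' (by linarith [(abs_le.mp h).1]) (abs_le.mp h).2
      _ = _ := by field_simp

variable [l.IsCountablyGenerated] {κ : ι → Measure ℤ} [∀ i, IsFiniteMeasure (κ i)]

theorem tendsto_integral_score_sq (hϑ : 0 < ϑ) (hD : Tendsto D l (𝓝[>] 0))
    (hκ : ∀ᶠ i in l, ∀ k, (κ i).real {k} = skellamProb (ϑ * D i) k) :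
    Tendsto (fun i => (D i)⁻¹ * ∫ k, score (D i) ϑ k ^ 2 ∂(κ i)) l (𝓝 (1 / ϑ)) := by
  have := tendsto_integral_skellam (tendsto_const_mul_nhdsGT_zero hϑ hD) hκ
    (f := fun i k => score (D i) ϑ k ^ 2) (C := (1 / ϑ + 1 + ϑ) ^ 2) (a := (1 / ϑ) ^ 2) ?_ ?_ ?_ ?_
  · have h2 := this.const_mul ϑ
    rw [show ϑ * (1 / ϑ) ^ 2 = 1 / ϑ by field_simp] at h2
    refine h2.congr fun i => ?_
    rw [smul_eq_mul, mul_inv]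
    field_simp
  · filter_upwards [eventually_pos_and_le_one hD] with i hi k
    exact norm_score_sq_le hϑ hi.1 hi.2 k
  · exact tendsto_inv_mul_score_zero_sq hϑ hD
  · simpa using (tendsto_score hϑ hD 1).pow 2
  · simpa using (tendsto_score hϑ hD (-1)).pow 2

theorem tendsto_integral_abs (hϑ : 0 < ϑ) (hD : Tendsto D l (𝓝[>] 0))
    (hκ : ∀ᶠ i in l, ∀ k, (κ i).real {k} = skellamProb (ϑ * D i) k) :
    Tendsto (fun i => (D i)⁻¹ * ∫ k, |(k : ℝ)| ∂(κ i)) l (𝓝 ϑ) := by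
  have := tendsto_integral_skellam (tendsto_const_mul_nhdsGT_zero hϑ hD) hκ
    (f := fun i k => |(k : ℝ)|) (C := 1) (a := 1) ?_ ?_ ?_ ?_
  · have h2 := this.const_mul ϑ
    rw [mul_one] at h2
    refine h2.congr fun i => ?_
    rw [smul_eq_mul, mul_inv]
    field_simp
  · refine Eventually.of_forall fun i k => ?_
    have := Real.add_one_le_exp (2 * k.natAbs : ℝ)
    rw [Nat.cast_natAbs, Int.cast_abs] at *
    rw [Real.norm_eq_abs, abs_abs, one_mul]
    linarith [abs_nonneg (k : ℝ)]
  · simpa using tendsto_const_nhds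
  · simpa using tendsto_const_nhds
  · simpa using tendsto_const_nhds

theorem tendsto_integral_sq_abs (hϑ : 0 < ϑ) (hD : Tendsto D l (𝓝[>] 0))
    (hκ : ∀ᶠ i in l, ∀ k, (κ i).real {k} = skellamProb (ϑ * D i) k) :
    Tendsto (fun i => (D i)⁻¹ * ∫ k, (|(k : ℝ)|) ^ 2 ∂(κ i)) l (𝓝 ϑ) := by
  have := tendsto_integral_skellam (tendsto_const_mul_nhdsGT_zero hϑ hD) hκ
    (f := fun i k => |(k : ℝ)| ^ 2) (C := 1) (a := 1) ?_ ?_ ?_ ?_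
  · have h2 := this.const_mul ϑ
    rw [mul_one] at h2
    refine h2.congr fun i => ?_
    rw [smul_eq_mul, mul_inv]
    field_simp
  · refine Eventually.of_forall fun i k => ?_
    have := Real.add_one_le_exp (k.natAbs : ℝ)
    rw [two_mul, Real.exp_add, Nat.cast_natAbs, Int.cast_abs] at *
    rw [norm_pow, Real.norm_eq_abs, abs_abs, one_mul, ← sq]
    gcongr
    linarith
  · simpa using tendsto_const_nhds
  · simpa using tendsto_const_nhds
  · simpa using tendsto_const_nhds

/-- Every integer has positive mass, and the score is strictly positive at any natural number
exceeding `ϑ * Δ`. -/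
lemma integral_score_sq_pos (hϑ : 0 < ϑ) (hΔ : 0 < Δ) {κ : Measure ℤ} [IsFiniteMeasure κ]
    (hκ : ∀ k, κ.real {k} = skellamProb (ϑ * Δ) k)
    (hint : Integrable (fun k => score Δ ϑ k ^ 2) κ) : 0 < ∫ k, score Δ ϑ k ^ 2 ∂κ := by
  rw [integral_pos_iff_support_of_nonneg (fun k => sq_nonneg _) hint]
  obtain ⟨j, hj⟩ := exists_nat_gt (ϑ * Δ)
  have hk : ((j : ℕ) : ℤ) ∈ Function.support fun k => score Δ ϑ k ^ 2 := by
    rw [Function.mem_support]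
    have h0 := besselSlope_nonneg (k := j) (sq_nonneg (ϑ * Δ / 2))
    have h1 : Δ < (j : ℝ) / ϑ := by rw [lt_div_iff₀ hϑ]; linarith
    have h2 : 0 ≤ Δ * (ϑ * Δ / 2 * besselSlope j ((ϑ * Δ / 2) ^ 2)) := by positivity
    have : 0 < score Δ ϑ j := by
      rw [score_eq hϑ hΔ]
      simp only [Int.cast_natCast, Nat.abs_cast, Int.natAbs_natCast]
      linarith
    positivity
  refine lt_of_lt_of_le ?_ (measure_mono (Set.singleton_subset_iff.mpr hk))
  have := skellamProb_pos (mul_pos hϑ hΔ) j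
  rw [← hκ, measureReal_def] at this
  exact (ENNReal.toReal_pos_iff.mp this).1

end Score

/-! ### Deterministic limits and Taylor bounds. -/

section Limits

variable {ι : Type*} {l : Filter ι}

lemma norm_pow_sub_pow_le {z w : ℂ} (hz : ‖z‖ ≤ 1) (hw : ‖w‖ ≤ 1) (n : ℕ) :
    ‖z ^ n - w ^ n‖ ≤ n * ‖z - w‖ := by
  induction n with
  | zero => simp
  | succ n ih =>
    have h1 : z ^ (n + 1) - w ^ (n + 1) = z * (z ^ n - w ^ n) + (z - w) * w ^ n := by ring
    have h2 : ‖w ^ n‖ ≤ 1 := by rw [norm_pow]; exact pow_le_one₀ (norm_nonneg _) hw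
    calc _ ≤ ‖z‖ * ‖z ^ n - w ^ n‖ + ‖z - w‖ * ‖w ^ n‖ := by
          rw [h1, ← norm_mul, ← norm_mul]; exact norm_add_le _ _
      _ ≤ 1 * (n * ‖z - w‖) + ‖z - w‖ * 1 := by gcongr
      _ = _ := by push_cast; ring

/-- Compare `z ^ n` with `exp (z - 1) ^ n`. Both bases lie in the unit disc, so the powers differ by
at most `n * ‖z - 1‖²`, which tends to `0`; no complex logarithm is needed. -/
lemma tendsto_pow_exp_of_tendsto_mul_sub_one {n : ι → ℕ} {z : ι → ℂ} {c : ℂ}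
    (hz : ∀ i, ‖z i‖ ≤ 1) (hz1 : Tendsto z l (𝓝 1))
    (h : Tendsto (fun i => (n i : ℂ) * (z i - 1)) l (𝓝 c)) :
    Tendsto (fun i => z i ^ n i) l (𝓝 (Complex.exp c)) := by
  have hexp : Tendsto (fun i => Complex.exp (z i - 1) ^ n i) l (𝓝 (Complex.exp c)) := by
    refine ((Complex.continuous_exp.tendsto c).comp h).congr fun i => ?_
    rw [Function.comp_apply, Complex.exp_nat_mul]
  have hsub0 : Tendsto (fun i => ‖z i - 1‖) l (𝓝 0) := by
    have := (hz1.sub_const 1).norm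
    rwa [sub_self, norm_zero] at this
  have hdiff : Tendsto (fun i => z i ^ n i - Complex.exp (z i - 1) ^ n i) l (𝓝 0) := by
    have hmaj : Tendsto (fun i => ‖(n i : ℂ) * (z i - 1)‖ * ‖z i - 1‖) l (𝓝 0) := by
      simpa using h.norm.mul hsub0
    refine squeeze_zero_norm' ?_ hmaj
    filter_upwards [hsub0.eventually (ge_mem_nhds one_pos)] with i hi
    have hw : ‖Complex.exp (z i - 1)‖ ≤ 1 := by
      rw [Complex.norm_exp, Real.exp_le_one_iff, Complex.sub_re, Complex.one_re, sub_nonpos]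
      exact (Complex.re_le_norm _).trans (hz i)
    refine (norm_pow_sub_pow_le (hz i) hw _).trans ?_
    rw [norm_mul, Complex.norm_natCast, mul_assoc, ← sq]
    gcongr
    have := Complex.norm_exp_sub_one_sub_id_le hi
    rwa [← norm_neg, show -(Complex.exp (z i - 1) - 1 - (z i - 1)) = z i - Complex.exp (z i - 1)
      by ring] at this
  simpa using hdiff.add hexp

lemma norm_exp_mul_I_sub_le (y : ℝ) :
    ‖Complex.exp (y * Complex.I) - 1 - y * Complex.I‖ ≤ 3 * y ^ 2 := by
  have hn : ‖(y : ℂ) * Complex.I‖ = |y| := by simp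
  by_cases hy : |y| ≤ 1
  · have := Complex.norm_exp_sub_one_sub_id_le (hn.trans_le hy)
    rw [hn, sq_abs] at this
    nlinarith [sq_nonneg y]
  · have h1 := norm_sub_le (Complex.exp (y * Complex.I) - 1) (y * Complex.I)
    have h2 := norm_sub_le (Complex.exp (y * Complex.I)) 1
    rw [Complex.norm_exp_ofReal_mul_I, norm_one] at h2
    rw [hn] at h1
    have := sq_abs y
    nlinarith

lemma norm_exp_mul_I_sub_add_le {y : ℝ} (hy : |y| ≤ 1) :
    ‖Complex.exp (y * Complex.I) - 1 - y * Complex.I + y ^ 2 / 2‖ ≤ y ^ 2 * |y| := by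
  have hn : ‖(y : ℂ) * Complex.I‖ = |y| := by simp
  have := Complex.exp_bound (hn.trans_le hy) (n := 3) (by norm_num)
  rw [hn] at this
  simp only [Finset.sum_range_succ, Finset.sum_range_zero] at this
  norm_num [Nat.factorial] at this
  have e : Complex.exp (y * Complex.I) - 1 - y * Complex.I + y ^ 2 / 2 =
      Complex.exp (y * Complex.I) - (1 + y * Complex.I + (y * Complex.I) ^ 2 / 2) := by
    rw [mul_pow, Complex.I_sq]; ring
  rw [e]
  refine this.trans ?_
  rw [← sq_abs]
  nlinarith [pow_nonneg (abs_nonneg y) 3]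

lemma tendsto_mul_exp_mul_I_sub {T y : ι → ℝ} {c : ℝ} (hy : Tendsto y l (𝓝 0))
    (hT : Tendsto (fun i => T i * y i ^ 2) l (𝓝 c)) :
    Tendsto (fun i => (T i : ℂ) * (Complex.exp (y i * Complex.I) - 1 - y i * Complex.I)) l
      (𝓝 (-(c : ℂ) / 2)) := by
  have h0 : Tendsto (fun i => |y i|) l (𝓝 0) := by simpa using hy.abs
  have h1 : Tendsto (fun i => (T i : ℂ) * (Complex.exp (y i * Complex.I) - 1 - y i * Complex.I
      + y i ^ 2 / 2)) l (𝓝 0) := by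
    have hmaj : Tendsto (fun i => |T i * y i ^ 2| * |y i|) l (𝓝 0) := by
      simpa using hT.abs.mul h0
    refine squeeze_zero_norm' ?_ hmaj
    filter_upwards [h0.eventually (ge_mem_nhds one_pos)] with i hi
    rw [norm_mul, Complex.norm_real, Real.norm_eq_abs, abs_mul, abs_of_nonneg (sq_nonneg (y i)),
      mul_assoc]
    gcongr
    exact norm_exp_mul_I_sub_add_le hi
  have h2 : Tendsto (fun i => ((T i * y i ^ 2 : ℝ) : ℂ) / 2) l (𝓝 ((c : ℂ) / 2)) :=
    ((Complex.continuous_ofReal.tendsto c).comp hT).div_const 2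
  have h3 := h1.sub h2
  rw [zero_sub, ← neg_div] at h3
  refine h3.congr fun i => ?_
  push_cast
  ring

lemma abs_log_one_add_sub_le {x : ℝ} (hx : |x| ≤ 1 / 2) :
    |Real.log (1 + x) - x + x ^ 2 / 2| ≤ 2 * (x ^ 2 * |x|) := by
  have h := Real.abs_log_sub_add_sum_range_le (x := -x) (by rw [abs_neg]; linarith) 2
  rw [abs_neg, sub_neg_eq_add] at h
  have h2 : |x| ^ (2 + 1) / (1 - |x|) ≤ 2 * (x ^ 2 * |x|) := by
    rw [div_le_iff₀ (by linarith), ← sq_abs x]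
    have := mul_nonneg (pow_nonneg (abs_nonneg x) 3) (sub_nonneg.mpr hx)
    ring_nf at this ⊢
    linarith
  refine le_trans (le_of_eq ?_) (h.trans h2)
  congr 1
  simp [Finset.sum_range_succ]
  ring

/-- Pathwise bound for a random count `A`: since `log (1 + x) - x` is close to `-x² / 2`, the
product is near `-c / 2` as soon as `x² * A` is near `c`. Both LAN proofs use it with `x = u / ϑ`
and `c = v²`. -/
lemma abs_mul_log_one_add_sub_add_le {x : ℝ} (hx : |x| ≤ 1 / 2) (A c : ℝ) :
    |A * (Real.log (1 + x) - x) + c / 2| ≤ 2 * |x ^ 2 * A - c| + 2 * |c| * |x| := by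
  have h := abs_log_one_add_sub_le hx
  set d := Real.log (1 + x) - x + x ^ 2 / 2 with hd
  have e : A * (Real.log (1 + x) - x) + c / 2 = A * d - (x ^ 2 * A - c) / 2 := by rw [hd]; ring
  have h1 : |A * d| ≤ 2 * (|x ^ 2 * A| * |x|) := by
    rw [abs_mul, abs_mul, abs_of_nonneg (sq_nonneg x)]
    calc |A| * |d| ≤ |A| * (2 * (x ^ 2 * |x|)) := by gcongr
      _ = _ := by ring
  have h2 : |x ^ 2 * A| ≤ |x ^ 2 * A - c| + |c| := by
    have := abs_add_le (x ^ 2 * A - c) c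
    rwa [sub_add_cancel] at this
  have h3 := abs_sub (A * d) ((x ^ 2 * A - c) / 2)
  rw [abs_div, abs_two] at h3
  rw [e]
  have h4 : |x ^ 2 * A| * |x| ≤ |x ^ 2 * A - c| * (1 / 2) + |c| * |x| := by
    nlinarith [abs_nonneg x, abs_nonneg (x ^ 2 * A - c)]
  linarith [abs_nonneg (x ^ 2 * A - c)]

end Limits

/-! ### Convergence in law and in probability. -/

section Probability

variable {𝓧 : ℝ → Type*} [∀ T, MeasurableSpace (𝓧 T)] {μ : ∀ T, Measure (𝓧 T)}
  [∀ T, IsProbabilityMeasure (μ T)]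

theorem tendstoInDistribution_gaussian {ξ : ∀ T, 𝓧 T → ℝ} (hξ : ∀ T, Measurable (ξ T))
    (h : ∀ s : ℝ, Tendsto (fun T => ∫ x, Complex.exp ((s * ξ T x : ℝ) * Complex.I) ∂(μ T)) atTop
      (𝓝 (Complex.exp (-((s ^ 2 : ℝ) : ℂ) / 2)))) :
    TendstoInDistribution ξ atTop (id : ℝ → ℝ) μ (gaussianReal 0 1) where
  forall_aemeasurable T := (hξ T).aemeasurable
  aemeasurable_limit := aemeasurable_id
  tendsto := by
    -- Lévy's continuity theorem is applied along sequences, which suffice because `atTop` on `ℝ` is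
    -- countably generated.
    refine tendsto_of_seq_tendsto fun u hu => ?_
    refine ProbabilityMeasure.tendsto_of_tendsto_charFun fun s => ?_
    have := (h s).comp hu
    convert! this using 2
    · rw [Function.comp_apply]
      change charFun ((μ _).map (ξ _)) s = _
      rw [charFun_apply_real, integral_map (hξ _).aemeasurable (by fun_prop)]
      simp
    · change charFun ((gaussianReal 0 1).map id) s = _
      rw [Measure.map_id, charFun_gaussianReal]
      congr 2
      push_cast
      ring

/-- Chebyshev: once `g ≤ δ / 2`, the event `δ ≤ |r|` forces `|Z| ≥ δ / 4`. -/
lemma tendsto_measure_of_abs_le {r Z : ∀ T, 𝓧 T → ℝ} {g : ℝ → ℝ}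
    (hr : ∀ᶠ T in atTop, ∀ x, |r T x| ≤ g T + 2 * |Z T x|) (hg : Tendsto g atTop (𝓝 0))
    (hZ : ∀ᶠ T in atTop, Integrable (fun x => Z T x ^ 2) (μ T))
    (hZ0 : Tendsto (fun T => ∫ x, Z T x ^ 2 ∂(μ T)) atTop (𝓝 0)) {δ : ℝ} (hδ : 0 < δ) :
    Tendsto (fun T => μ T {x | δ ≤ |r T x|}) atTop (𝓝 0) := by
  have hmaj : Tendsto (fun T => ENNReal.ofReal (((δ / 4) ^ 2)⁻¹ * ∫ x, Z T x ^ 2 ∂(μ T)))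
      atTop (𝓝 0) := by
    have := ENNReal.tendsto_ofReal (hZ0.const_mul ((δ / 4) ^ 2)⁻¹)
    rwa [mul_zero, ENNReal.ofReal_zero] at this
  refine tendsto_of_tendsto_of_tendsto_of_le_of_le' tendsto_const_nhds hmaj
    (Eventually.of_forall fun _ => zero_le) ?_
  filter_upwards [hr, hZ, hg.eventually (ge_mem_nhds (half_pos hδ))] with T h1 h2 h3
  have hm := mul_meas_ge_le_integral_of_nonneg (ae_of_all _ fun x => sq_nonneg (Z T x)) h2
    ((δ / 4) ^ 2)
  rw [← le_inv_mul_iff₀ (by positivity)] at hm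
  refine (measure_mono ?_).trans ((ofReal_measureReal (measure_ne_top _ _)).symm.le.trans
    (ENNReal.ofReal_le_ofReal hm))
  intro x hx
  have h4 := h1 x
  have hx' : δ ≤ |r T x| := hx
  change (δ / 4) ^ 2 ≤ Z T x ^ 2
  rw [← sq_abs (Z T x)]
  have : δ / 4 ≤ |Z T x| := by linarith
  gcongr

end Probability

lemma integral_sub_const_sq {Ω : Type*} [MeasurableSpace Ω] {μ : Measure Ω}
    [IsProbabilityMeasure μ] {X : Ω → ℝ} (hX : MemLp X 2 μ) (c : ℝ) :
    ∫ ω, (X ω - c) ^ 2 ∂μ = variance X μ + (∫ ω, X ω ∂μ - c) ^ 2 := by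
  have h1 : Integrable X μ := hX.integrable (by norm_num)
  have h2 : Integrable (fun ω => X ω ^ 2) μ := hX.integrable_sq
  have e : ∀ ω, (X ω - c) ^ 2 = X ω ^ 2 - 2 * c * X ω + c ^ 2 := fun ω => by ring
  simp_rw [e]
  rw [integral_add (f := fun ω => X ω ^ 2 - 2 * c * X ω) (h2.sub (h1.const_mul _))
    (integrable_const _), integral_sub h2 (h1.const_mul _), integral_const_mul, integral_const, variance_eq_sub hX]
  simp
  ring

theorem rnDeriv_toReal_of_countable {α : Type*} [MeasurableSpace α] [Countable α]
    [MeasurableSingletonClass α] {μ ν : Measure α} [IsFiniteMeasure μ] [IsFiniteMeasure ν]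
    (h : ∀ x, 0 < ν.real {x}) :
    μ ≪ ν ∧ ∀ x, (μ.rnDeriv ν x).toReal = μ.real {x} / ν.real {x} := by
  have hac : μ ≪ ν := by
    refine Measure.AbsolutelyContinuous.mk fun s _ hs => ?_
    rcases s.eq_empty_or_nonempty with rfl | ⟨x, hx⟩
    · simp
    · have := measure_mono_null (Set.singleton_subset_iff.mpr hx) hs
      exact absurd (by rw [measureReal_def, this]; rfl) (h x).ne'
  refine ⟨hac, fun x => ?_⟩
  rw [eq_div_iff (h x).ne', measureReal_def, measureReal_def, ← ENNReal.toReal_mul]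
  congr 1
  conv_rhs => rw [← Measure.withDensity_rnDeriv_eq μ ν hac]
  rw [withDensity_apply _ (measurableSet_singleton x), Measure.restrict_singleton,
    lintegral_smul_measure, lintegral_dirac, smul_eq_mul, mul_comm]

/-! ### Central limit theorem and law of large numbers for the increments. -/

section Microscopic

variable {ϑ : ℝ} {D : ℝ → ℝ}

lemma tendsto_nhdsGT_zero_of_pos (hD : ∀ T, 0 < T → 0 < D T) (hD0 : Tendsto D atTop (𝓝 0)) :
    Tendsto D atTop (𝓝[>] 0) := by
  rw [tendsto_nhdsWithin_iff]
  refine ⟨hD0, ?_⟩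
  filter_upwards [eventually_gt_atTop 0] with T hT using hD T hT

lemma tendsto_floor_div_mul_div (hD : ∀ T, 0 < T → 0 < D T) (hD0 : Tendsto D atTop (𝓝 0)) :
    Tendsto (fun T => (⌊T / D T⌋₊ : ℝ) * D T / T) atTop (𝓝 1) := by
  have h1 : Tendsto (fun T => 1 - D T / T) atTop (𝓝 1) := by
    have := (hD0.div_atTop tendsto_id).const_sub 1
    simpa using this
  refine tendsto_of_tendsto_of_tendsto_of_le_of_le' h1 tendsto_const_nhds ?_ ?_
  · filter_upwards [eventually_gt_atTop 0] with T hT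
    have hd := hD T hT
    have := (Nat.lt_floor_add_one (T / D T)).le
    rw [div_le_iff₀ hd] at this
    rw [le_div_iff₀ hT, sub_mul, div_mul_cancel₀ _ hT.ne']
    linarith
  · filter_upwards [eventually_gt_atTop 0] with T hT
    have hd := hD T hT
    have := Nat.floor_le (div_pos hT hd).le
    rw [le_div_iff₀ hd] at this
    rw [div_le_one hT]
    exact this

variable {κ : ℝ → Measure ℤ} [∀ T, IsProbabilityMeasure (κ T)]

/-- The characteristic function is `φ ^ n` with `φ` that of one normalised score, so it suffices
that `n * (φ - 1)` tends to `-s² / 2`; this follows from the small-intensity limit and `n * D ~ T`.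
-/
theorem tendsto_integral_exp_sum_score (hϑ : 0 < ϑ) (hD : ∀ T, 0 < T → 0 < D T)
    (hD0 : Tendsto D atTop (𝓝 0))
    (hκ : ∀ T, 0 < T → ∀ k, (κ T).real {k} = skellamProb (ϑ * D T) k)
    {I : ℝ → ℝ} (hI : ∀ T, 0 < T → 0 < I T)
    (hIT : Tendsto (fun T => T / I T) atTop (𝓝 ϑ)) (s : ℝ) :
    Tendsto (fun T => ∫ y : Fin ⌊T / D T⌋₊ → ℤ,
        Complex.exp ((s * ((√(I T))⁻¹ * ∑ j, score (D T) ϑ (y j)) : ℝ) * Complex.I)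
          ∂(Measure.pi fun _ => κ T)) atTop
      (𝓝 (Complex.exp (-((s ^ 2 : ℝ) : ℂ) / 2))) := by
  have hDp := tendsto_nhdsGT_zero_of_pos hD hD0
  have hlam := tendsto_const_mul_nhdsGT_zero hϑ hDp
  have hκ' : ∀ᶠ T in atTop, ∀ k, (κ T).real {k} = skellamProb (ϑ * D T) k := by
    filter_upwards [eventually_gt_atTop 0] with T hT using hκ T hT
  let w : ℝ → ℤ → ℝ := fun T k => s * ((√(I T))⁻¹ * score (D T) ϑ k)
  have hTw : ∀ T, 0 < T → ∀ k, T * w T k ^ 2 = s ^ 2 * (T / I T) * score (D T) ϑ k ^ 2 := by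
    intro T hT k
    have : (√(I T))⁻¹ ^ 2 = (I T)⁻¹ := by rw [inv_pow, Real.sq_sqrt (hI T hT).le]
    simp only [w]
    rw [mul_pow, mul_pow, this]
    ring
  have hprod : ∀ T, ∫ y : Fin ⌊T / D T⌋₊ → ℤ,
        Complex.exp ((s * ((√(I T))⁻¹ * ∑ j, score (D T) ϑ (y j)) : ℝ) * Complex.I)
          ∂(Measure.pi fun _ => κ T) =
      (∫ k, Complex.exp (w T k * Complex.I) ∂(κ T)) ^ ⌊T / D T⌋₊ := by
    intro T
    have : ∀ y : Fin ⌊T / D T⌋₊ → ℤ,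
        Complex.exp ((s * ((√(I T))⁻¹ * ∑ j, score (D T) ϑ (y j)) : ℝ) * Complex.I) =
        ∏ j, Complex.exp (w T (y j) * Complex.I) := by
      intro y
      rw [← Complex.exp_sum, ← Finset.sum_mul, ← Complex.ofReal_sum]
      simp only [w, Finset.mul_sum]
    simp_rw [this]
    rw [integral_fintype_prod_eq_prod (f := fun _ k => Complex.exp (w T k * Complex.I))]
    simp
  simp_rw [hprod]
  -- Removing the linear term costs nothing because the score is centred, and it makes `F` quadratic
  -- in the score; hence `F T 0 = o(D T)`, as the small-intensity limit requires.
  let F : ℝ → ℤ → ℂ := fun T k => T * (Complex.exp (w T k * Complex.I) - 1 - w T k * Complex.I)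
  have hFle : ∀ T, 0 < T → ∀ k, ‖F T k‖ ≤ 3 * (s ^ 2 * (T / I T) * score (D T) ϑ k ^ 2) := by
    intro T hT k
    rw [norm_mul, Complex.norm_real, Real.norm_of_nonneg hT.le, ← hTw T hT]
    nlinarith [norm_exp_mul_I_sub_le (w T k)]
  have hratio : ∀ᶠ T in atTop, T / I T ≤ ϑ + 1 :=
    hIT.eventually (ge_mem_nhds (by linarith))
  have hpos : ∀ᶠ T : ℝ in atTop, 0 < T := eventually_gt_atTop 0
  have hFpt : ∀ k : ℤ, |(k : ℝ)| = 1 → Tendsto (fun T => F T k) atTop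
      (𝓝 (-((s ^ 2 / ϑ : ℝ) : ℂ) / 2)) := by
    intro k hk
    have h1 : Tendsto (fun T => T * w T k ^ 2) atTop (𝓝 (s ^ 2 / ϑ)) := by
      have := (hIT.const_mul (s ^ 2)).mul ((tendsto_score hϑ hDp k).pow 2)
      rw [hk, show s ^ 2 * ϑ * (1 / ϑ) ^ 2 = s ^ 2 / ϑ by field_simp] at this
      refine this.congr' ?_
      filter_upwards [hpos] with T hT
      rw [hTw T hT]
    have h2 : Tendsto (fun T => w T k) atTop (𝓝 0) := by
      have h3 : Tendsto (fun T => w T k ^ 2) atTop (𝓝 0) := by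
        refine (h1.div_atTop tendsto_id).congr' ?_
        filter_upwards [hpos] with T hT
        simp only [id]
        field_simp
      rw [tendsto_zero_iff_abs_tendsto_zero]
      have := (Real.continuous_sqrt.tendsto 0).comp h3
      rw [Real.sqrt_zero] at this
      exact this.congr fun T => Real.sqrt_sq_eq_abs _
    exact tendsto_mul_exp_mul_I_sub h2 h1
  have hmain := tendsto_integral_skellam hlam hκ' (f := F)
    (C := 3 * (s ^ 2 * (ϑ + 1) * (1 / ϑ + 1 + ϑ) ^ 2)) (a := -((s ^ 2 / ϑ : ℝ) : ℂ) / 2)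
    ?_ ?_ (hFpt 1 (by simp)) (hFpt (-1) (by simp))
  rotate_left
  · filter_upwards [hpos, hratio, eventually_pos_and_le_one hDp] with T hT hr hd k
    have hsc := norm_score_sq_le hϑ hd.1 hd.2 k
    rw [Real.norm_of_nonneg (sq_nonneg _)] at hsc
    refine (hFle T hT k).trans ?_
    have := hI T hT
    calc _ ≤ 3 * (s ^ 2 * (ϑ + 1) * ((1 / ϑ + 1 + ϑ) ^ 2 * Real.exp (2 * k.natAbs))) := by gcongr
      _ = _ := by ring
  · have hmaj : Tendsto (fun T => 3 * (s ^ 2 * (T / I T)) *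
        ((ϑ * D T)⁻¹ * score (D T) ϑ 0 ^ 2)) atTop (𝓝 0) := by
      have := ((hIT.const_mul (s ^ 2)).const_mul 3).mul (tendsto_inv_mul_score_zero_sq hϑ hDp)
      rwa [mul_zero] at this
    refine squeeze_zero_norm' ?_ hmaj
    filter_upwards [hpos] with T hT
    have hd := hD T hT
    rw [norm_smul, Real.norm_of_nonneg (by positivity)]
    calc _ ≤ (ϑ * D T)⁻¹ * (3 * (s ^ 2 * (T / I T) * score (D T) ϑ 0 ^ 2)) := by
          gcongr; exact hFle T hT 0
      _ = _ := by ring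
  have hint : ∀ᶠ T in atTop, Integrable (score (D T) ϑ) (κ T) := by
    filter_upwards [hpos, eventually_pos_and_le_one hDp] with T hT hd
    refine integrable_of_le_exp (mul_pos hϑ hd.1) (hκ T hT) (C := 1 / ϑ + 1 + ϑ) fun k => ?_
    refine (abs_score_le hϑ hd.1 hd.2 k).trans ?_
    gcongr
    linarith [Nat.cast_nonneg (α := ℝ) k.natAbs]
  have hmean : ∀ᶠ T in atTop, ∫ k, F T k ∂(κ T) =
      T * ((∫ k, Complex.exp (w T k * Complex.I) ∂(κ T)) - 1) := by
    filter_upwards [hpos, hint] with T hT hi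
    have h0 := integral_score hϑ (hD T hT) (hκ T hT) hi
    have hwint : Integrable (fun k => (w T k : ℂ) * Complex.I) (κ T) :=
      (((hi.const_mul _).const_mul _).ofReal).mul_const _
    have hw0 : ∫ k, (w T k : ℂ) * Complex.I ∂(κ T) = 0 := by
      rw [integral_mul_const, integral_complex_ofReal]
      simp only [w]
      rw [integral_const_mul, integral_const_mul, h0]
      simp
    have he : Integrable (fun k => Complex.exp (w T k * Complex.I)) (κ T) :=
      Integrable.of_bound (C := 1) (measurable_of_countable _).aestronglyMeasurable
        (ae_of_all _ fun k => by rw [Complex.norm_exp_ofReal_mul_I])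
    simp only [F]
    rw [integral_const_mul, integral_sub (f := fun k => Complex.exp (w T k * Complex.I) - 1)
      (he.sub (integrable_const _)) hwint, integral_sub he (integrable_const _), hw0]
    simp
  have hn := tendsto_floor_div_mul_div hD hD0
  have hlim : Tendsto (fun T => (⌊T / D T⌋₊ : ℂ) *
      ((∫ k, Complex.exp (w T k * Complex.I) ∂(κ T)) - 1)) atTop
      (𝓝 (-((s ^ 2 : ℝ) : ℂ) / 2)) := by
    have h1 := (((Complex.continuous_ofReal.tendsto 1).comp (hn)).mul_const (ϑ : ℂ)).mul hmain
    have hc : ((1 : ℝ) : ℂ) * (ϑ : ℂ) * (-((s ^ 2 / ϑ : ℝ) : ℂ) / 2) =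
        -((s ^ 2 : ℝ) : ℂ) / 2 := by
      have : (ϑ : ℂ) ≠ 0 := by exact_mod_cast hϑ.ne'
      push_cast
      field_simp
    rw [hc] at h1
    refine h1.congr' ?_
    filter_upwards [hpos, hmean] with T hT hm
    have hd : (D T : ℂ) ≠ 0 := by exact_mod_cast (hD T hT).ne'
    have hT' : (T : ℂ) ≠ 0 := by exact_mod_cast hT.ne'
    have hϑ' : (ϑ : ℂ) ≠ 0 := by exact_mod_cast hϑ.ne'
    rw [hm, Function.comp_apply, Complex.real_smul]
    generalize ∫ k, Complex.exp (w T k * Complex.I) ∂(κ T) = q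
    push_cast
    field_simp
  have hle : ∀ T, ‖∫ k, Complex.exp (w T k * Complex.I) ∂(κ T)‖ ≤ 1 := by
    intro T
    refine (norm_integral_le_of_norm_le_const (C := 1) (ae_of_all _ fun k => ?_)).trans ?_
    · rw [Complex.norm_exp_ofReal_mul_I]
    · simp
  refine tendsto_pow_exp_of_tendsto_mul_sub_one hle ?_ hlim
  -- Multiplying the small-intensity limit by `ϑ * D T`, which tends to `0`, gives `T * (φ - 1) →
  -- 0`; for `T ≥ 1` this forces `φ → 1`.
  have hTz : Tendsto (fun T : ℝ => (T : ℂ) *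
      ((∫ k, Complex.exp (w T k * Complex.I) ∂(κ T)) - 1)) atTop (𝓝 0) := by
    have h1 := ((Complex.continuous_ofReal.tendsto 0).comp
      (hlam.mono_right nhdsWithin_le_nhds)).mul hmain
    rw [Complex.ofReal_zero, zero_mul] at h1
    refine h1.congr' ?_
    filter_upwards [hpos, hmean] with T hT hm
    have hl : ((ϑ * D T : ℝ) : ℂ) ≠ 0 := by exact_mod_cast (mul_pos hϑ (hD T hT)).ne'
    rw [hm, Function.comp_apply, Complex.real_smul, Complex.ofReal_inv, ← mul_assoc,
      mul_inv_cancel₀ hl, one_mul]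
  have hz : Tendsto (fun T => (∫ k, Complex.exp (w T k * Complex.I) ∂(κ T)) - 1) atTop
      (𝓝 0) := by
    refine squeeze_zero_norm' ?_ (by simpa using hTz.norm)
    filter_upwards [eventually_ge_atTop 1] with T hT
    rw [abs_of_nonneg (by linarith)]
    nlinarith [norm_nonneg ((∫ k, Complex.exp (w T k * Complex.I) ∂(κ T)) - 1)]
  simpa using hz.add_const 1

lemma memLp_abs_two {lam : ℝ} (h : 0 < lam) {κ : Measure ℤ} [IsFiniteMeasure κ]
    (hκ : ∀ k, κ.real {k} = skellamProb lam k) : MemLp (fun k : ℤ => |(k : ℝ)|) 2 κ := by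
  rw [memLp_two_iff_integrable_sq (measurable_of_countable _).aestronglyMeasurable]
  refine integrable_of_le_exp h hκ (C := 1) fun k => ?_
  have := Real.add_one_le_exp (k.natAbs : ℝ)
  rw [two_mul, Real.exp_add, Nat.cast_natAbs, Int.cast_abs] at *
  rw [norm_pow, Real.norm_eq_abs, abs_abs, one_mul, ← sq]
  gcongr
  linarith

lemma memLp_sum_abs {lam : ℝ} (h : 0 < lam) {κ : Measure ℤ} [IsProbabilityMeasure κ]
    (hκ : ∀ k, κ.real {k} = skellamProb lam k) (n : ℕ) :
    MemLp (fun y : Fin n → ℤ => ∑ j, |((y j : ℤ) : ℝ)|) 2 (Measure.pi fun _ => κ) :=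
  memLp_finsetSum _ fun j _ =>
    (memLp_abs_two h hκ).comp_measurePreserving (measurePreserving_eval _ j)

/-- Split the second moment into variance and squared bias. The variance is at most `x⁴ * n *
E|k|²`, of order `x² * (x² T)`, and the mean tends to `b * ϑ` because `E|k| ~ ϑ * D`. -/
theorem tendsto_integral_sum_abs_sub_sq (hϑ : 0 < ϑ) (hD : ∀ T, 0 < T → 0 < D T)
    (hD0 : Tendsto D atTop (𝓝 0))
    (hκ : ∀ T, 0 < T → ∀ k, (κ T).real {k} = skellamProb (ϑ * D T) k)
    {x : ℝ → ℝ} {b : ℝ} (hx : Tendsto x atTop (𝓝 0))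
    (hxT : Tendsto (fun T => x T ^ 2 * T) atTop (𝓝 b)) :
    Tendsto (fun T => ∫ y : Fin ⌊T / D T⌋₊ → ℤ,
      (x T ^ 2 * ∑ j, |((y j : ℤ) : ℝ)| - b * ϑ) ^ 2 ∂(Measure.pi fun _ => κ T)) atTop (𝓝 0) := by
  have hDp := tendsto_nhdsGT_zero_of_pos hD hD0
  have hκ' : ∀ᶠ T in atTop, ∀ k, (κ T).real {k} = skellamProb (ϑ * D T) k := by
    filter_upwards [eventually_gt_atTop 0] with T hT using hκ T hT
  have hn := tendsto_floor_div_mul_div hD hD0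
  have h1 := tendsto_integral_abs hϑ hDp hκ'
  have h2 := tendsto_integral_sq_abs hϑ hDp hκ'
  have hvar : Tendsto (fun T => x T ^ 2 * (x T ^ 2 * T) * ((⌊T / D T⌋₊ : ℝ) * D T / T) *
      ((D T)⁻¹ * ∫ k, (|(k : ℝ)|) ^ 2 ∂(κ T))) atTop (𝓝 0) := by
    have := (((hx.pow 2).mul hxT).mul hn).mul h2
    simpa using this
  have hmean : Tendsto (fun T => ((x T ^ 2 * T) * ((⌊T / D T⌋₊ : ℝ) * D T / T) *
      ((D T)⁻¹ * ∫ k, |(k : ℝ)| ∂(κ T)) - b * ϑ) ^ 2) atTop (𝓝 0) := by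
    have := (((hxT.mul hn).mul h1).sub_const (b * ϑ)).pow 2
    simpa using this
  have hmaj := hvar.add hmean
  rw [add_zero] at hmaj
  refine squeeze_zero' (Eventually.of_forall fun T => integral_nonneg fun y => sq_nonneg _) ?_ hmaj
  filter_upwards [eventually_gt_atTop 0] with T hT
  have hd := hD T hT
  have hlam := mul_pos hϑ hd
  have hm := memLp_abs_two hlam (hκ T hT)
  rw [integral_sub_const_sq ((memLp_sum_abs hlam (hκ T hT) _).const_mul (x T ^ 2)),
    variance_const_mul, integral_const_mul]
  have hv := variance_sum_pi (ι := Fin ⌊T / D T⌋₊) (μ := fun _ => κ T)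
    (X := fun _ k => |(k : ℝ)|) (fun _ => hm)
  have hsum : (∑ j : Fin ⌊T / D T⌋₊, fun y : Fin ⌊T / D T⌋₊ → ℤ => |((y j : ℤ) : ℝ)|) =
      fun y => ∑ j, |((y j : ℤ) : ℝ)| := by ext y; simp
  rw [hsum] at hv
  have he : ∫ y : Fin ⌊T / D T⌋₊ → ℤ, ∑ j, |((y j : ℤ) : ℝ)| ∂(Measure.pi fun _ => κ T) =
      ⌊T / D T⌋₊ * ∫ k, |(k : ℝ)| ∂(κ T) := by
    rw [integral_finsetSum]
    · have : ∀ j : Fin ⌊T / D T⌋₊, ∫ y : Fin ⌊T / D T⌋₊ → ℤ, |((y j : ℤ) : ℝ)|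
          ∂(Measure.pi fun _ => κ T) = ∫ k, |(k : ℝ)| ∂(κ T) :=
        fun j => integral_comp_eval (i := j) (X := fun _ => ℤ) (μ := fun _ => κ T)
          (f := fun k : ℤ => |(k : ℝ)|)
          (measurable_of_countable _).aestronglyMeasurable
      simp [this]
    · intro j _
      exact (hm.comp_measurePreserving (measurePreserving_eval _ j)).integrable (by norm_num)
  rw [hv, he]
  simp only [Finset.sum_const, Finset.card_univ, Fintype.card_fin, nsmul_eq_mul]
  have hvle : variance (fun k : ℤ => |(k : ℝ)|) (κ T) ≤ ∫ k, |(k : ℝ)| ^ 2 ∂(κ T) := by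
    have := variance_le_expectation_sq (μ := κ T) (X := fun k : ℤ => |(k : ℝ)|)
      (measurable_of_countable _).aestronglyMeasurable
    exact this
  gcongr ?_ + ?_
  · calc _ ≤ (x T ^ 2) ^ 2 * (⌊T / D T⌋₊ * ∫ k, |(k : ℝ)| ^ 2 ∂(κ T)) := by gcongr
      _ = _ := by
        generalize ∫ k, |(k : ℝ)| ^ 2 ∂(κ T) = q
        field_simp
  · apply le_of_eq
    field_simp

end Microscopic

/-! ### Local expansion of the log-likelihood and the information. -/

lemma log_skellamProb {lam : ℝ} (h : 0 < lam) (k : ℤ) : Real.log (skellamProb lam k) =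
    -lam + k.natAbs * Real.log (lam / 2) + Real.log (besselSeries k.natAbs ((lam / 2) ^ 2)) := by
  have := besselSeries_pos (k := k.natAbs) (sq_nonneg (lam / 2))
  rw [skellamProb_eq, Real.log_mul (Real.exp_pos _).ne' (by positivity), Real.log_exp,
    Real.log_mul (by positivity) this.ne', Real.log_pow]
  ring

/-- Of the three parts of the log probability, `-λ` is linear in the parameter and `|k| * log (λ /
2)` leaves exactly the logarithmic correction. The Bessel part, in the variable `(λ / 2)²`, has a
remainder quadratic in `u * Δ`. -/
lemma abs_log_skellamProb_sub_le {ϑ u Δ : ℝ} (hϑ : 0 < ϑ) (hu : 0 < ϑ + u) (huϑ : |u| ≤ ϑ)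
    (hΔ : 0 < Δ) (hΔ1 : Δ ≤ 1) (k : ℤ) :
    |Real.log (skellamProb ((ϑ + u) * Δ) k) - Real.log (skellamProb (ϑ * Δ) k) -
      u * score Δ ϑ k - |(k : ℝ)| * (Real.log (1 + u / ϑ) - u / ϑ)| ≤
      u ^ 2 * Δ ^ 2 * (ϑ ^ 2 + 1) := by
  have hz : 0 ≤ (ϑ * Δ / 2) ^ 2 := sq_nonneg _
  have hz' : 0 ≤ ((ϑ + u) * Δ / 2) ^ 2 := sq_nonneg _
  have hlog : Real.log ((ϑ + u) * Δ / 2) = Real.log (ϑ * Δ / 2) + Real.log (1 + u / ϑ) := by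
    rw [← Real.log_mul (by positivity)]
    · congr 1; field_simp
    · rw [show 1 + u / ϑ = (ϑ + u) / ϑ by field_simp]; positivity
  have hG := abs_log_besselSeries_sub_le (k := k.natAbs) hz hz'
  have hb0 := besselSlope_nonneg (k := k.natAbs) hz
  have hb1 := besselSlope_le_one (k := k.natAbs) hz
  rw [log_skellamProb (mul_pos hu hΔ), log_skellamProb (mul_pos hϑ hΔ), score_eq hϑ hΔ, hlog,
    Nat.cast_natAbs, Int.cast_abs]
  set b := besselSlope k.natAbs ((ϑ * Δ / 2) ^ 2)
  set g' := Real.log (besselSeries k.natAbs (((ϑ + u) * Δ / 2) ^ 2))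
  set g := Real.log (besselSeries k.natAbs ((ϑ * Δ / 2) ^ 2))
  have hsq : (((ϑ + u) * Δ / 2) ^ 2 - (ϑ * Δ / 2) ^ 2) ^ 2 ≤ u ^ 2 * Δ ^ 2 * ϑ ^ 2 := by
    have e : ((ϑ + u) * Δ / 2) ^ 2 - (ϑ * Δ / 2) ^ 2 = u * Δ * (Δ * ((2 * ϑ + u) / 4)) := by ring
    rw [e, mul_pow, mul_pow]
    have h := abs_le.mp huϑ
    have h2 : 0 ≤ (2 * ϑ + u) / 4 := by linarith
    have h3 : Δ * ((2 * ϑ + u) / 4) ≤ ϑ := by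
      calc Δ * ((2 * ϑ + u) / 4) ≤ 1 * ((2 * ϑ + u) / 4) := by gcongr
        _ ≤ ϑ := by linarith
    gcongr
  -- The leftover `u² Δ² b / 4` is the quadratic part of the increment of `(ϑ * Δ / 2)²`, which the
  -- score does not see.
  have e : -((ϑ + u) * Δ) + |(k : ℝ)| * (Real.log (ϑ * Δ / 2) + Real.log (1 + u / ϑ)) + g' -
      (-(ϑ * Δ) + |(k : ℝ)| * Real.log (ϑ * Δ / 2) + g) -
      u * (|(k : ℝ)| / ϑ + Δ * (ϑ * Δ / 2 * b - 1)) -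
      |(k : ℝ)| * (Real.log (1 + u / ϑ) - u / ϑ) =
      (g' - g - (((ϑ + u) * Δ / 2) ^ 2 - (ϑ * Δ / 2) ^ 2) * b) + u ^ 2 * Δ ^ 2 * (b / 4) := by ring
  rw [e]
  have h2 : |u ^ 2 * Δ ^ 2 * (b / 4)| ≤ u ^ 2 * Δ ^ 2 * 1 := by
    rw [abs_of_nonneg (by positivity)]
    gcongr
    linarith
  calc _ ≤ _ := abs_add_le _ _
    _ ≤ u ^ 2 * Δ ^ 2 * ϑ ^ 2 + u ^ 2 * Δ ^ 2 * 1 := add_le_add (hG.trans hsq) h2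
    _ = _ := by ring

section Local

variable {ϑ : ℝ} {I : ℝ → ℝ}

lemma tendsto_local_sq_mul (hI : ∀ T, 0 < T → 0 < I T)
    (hIT : Tendsto (fun T => T / I T) atTop (𝓝 ϑ)) (v : ℝ) :
    Tendsto (fun T => (v / √(I T)) ^ 2 * T) atTop (𝓝 (v ^ 2 * ϑ)) := by
  refine (hIT.const_mul (v ^ 2)).congr' ?_
  filter_upwards [eventually_gt_atTop 0] with T hT
  rw [div_pow, Real.sq_sqrt (hI T hT).le]
  ring

lemma tendsto_local (hI : ∀ T, 0 < T → 0 < I T)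
    (hIT : Tendsto (fun T => T / I T) atTop (𝓝 ϑ)) (v : ℝ) :
    Tendsto (fun T => v / √(I T)) atTop (𝓝 0) := by
  have h := (tendsto_local_sq_mul hI hIT v).div_atTop tendsto_id
  have h2 : Tendsto (fun T => (v / √(I T)) ^ 2) atTop (𝓝 0) := by
    refine h.congr' ?_
    filter_upwards [eventually_gt_atTop 0] with T hT
    simp only [id]
    field_simp
  rw [tendsto_zero_iff_abs_tendsto_zero]
  have := (Real.continuous_sqrt.tendsto 0).comp h2
  rw [Real.sqrt_zero] at this
  exact this.congr fun T => Real.sqrt_sq_eq_abs _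

end Local

section Model

variable {Ω : Type*} [MeasurableSpace Ω]

lemma information_eq {P : Measure Ω} {X : ℝ≥0 → Ω → ℤ} (hX : ∀ t, Measurable (X t)) (ϑ T : ℝ)
    {Δ : ℝ} (hΔ : 0 < Δ) : information P X ϑ T Δ =
      T * (Δ⁻¹ * ∫ k, score Δ ϑ k ^ 2 ∂(P.map (X Δ.toNNReal))) := by
  rw [integral_map (hX _).aemeasurable (measurable_of_countable _).aestronglyMeasurable]
  simp only [score, mul_pow]
  rw [integral_const_mul, information]
  field_simp

lemma isProbabilityMeasure_observationLaw {P : Measure Ω} [IsProbabilityMeasure P]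
    {X : ℝ≥0 → Ω → ℤ} (hX : ∀ t, Measurable (X t)) (T Δ : ℝ) :
    IsProbabilityMeasure (observationLaw P X T Δ) :=
  Measure.isProbabilityMeasure_map (measurable_observation hX T Δ).aemeasurable

variable {P : Measure Ω} {ϑ : ℝ} {N : ℝ≥0 → Ω → ℕ} {ε : ℕ → Ω → ℤ}

lemma IsModel.measurable_compound (h : IsModel P ϑ N ε) (t : ℝ≥0) :
    Measurable (compound N ε t) :=
  AcrossScales.measurable_compound h.poisson.measurable h.measurable_sign t

/-- A general filter covers both the limit along `Δ_T` and the limit `Δ → 0⁺` at fixed `T`; time `1`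
suffices because the information is linear in `T`. -/
lemma IsModel.tendsto_information (h : IsModel P ϑ N ε) (hϑ : 0 < ϑ) {ι : Type*} {l : Filter ι}
    [l.IsCountablyGenerated] {D : ι → ℝ} (hD : Tendsto D l (𝓝[>] 0)) :
    Tendsto (fun i => information P (compound N ε) ϑ 1 (D i)) l (𝓝 (1 / ϑ)) := by
  have := h.isProbabilityMeasure
  have : ∀ t, IsProbabilityMeasure (P.map (compound N ε t)) := fun t =>
    Measure.isProbabilityMeasure_map (h.measurable_compound t).aemeasurable
  have hpos : ∀ᶠ i in l, 0 < D i := hD.eventually self_mem_nhdsWithin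
  refine (tendsto_integral_score_sq (κ := fun i => P.map (compound N ε (D i).toNNReal)) hϑ hD
    ?_).congr' ?_
  · filter_upwards [hpos] with i hi k using h.measureReal_compound hϑ hi k
  · filter_upwards [hpos] with i hi
    rw [information_eq h.measurable_compound _ _ hi, one_mul]

lemma IsModel.integrable_score_sq (h : IsModel P ϑ N ε) (hϑ : 0 < ϑ) {Δ : ℝ} (hΔ : 0 < Δ) :
    Integrable (fun k => score Δ ϑ k ^ 2) (P.map (compound N ε Δ.toNNReal)) := by
  have := h.isProbabilityMeasure
  have hm := Measure.isProbabilityMeasure_map (h.measurable_compound Δ.toNNReal).aemeasurable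
    (μ := P)
  refine integrable_of_le_exp (mul_pos hϑ hΔ) (h.measureReal_compound hϑ hΔ)
    (C := (1 / ϑ + Δ * (1 + ϑ * Δ)) ^ 2) fun k => ?_
  rw [norm_pow, Real.norm_eq_abs, two_mul, Real.exp_add, ← sq, ← mul_pow]
  gcongr
  rw [score_eq hϑ hΔ]
  have h0 := besselSlope_nonneg (k := k.natAbs) (sq_nonneg (ϑ * Δ / 2))
  have h1 := besselSlope_le_one (k := k.natAbs) (sq_nonneg (ϑ * Δ / 2))
  set b := besselSlope k.natAbs ((ϑ * Δ / 2) ^ 2)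
  have h2 := Real.add_one_le_exp (k.natAbs : ℝ)
  rw [Nat.cast_natAbs, Int.cast_abs] at *
  have h5 : 1 ≤ Real.exp |(k : ℝ)| := Real.one_le_exp (abs_nonneg _)
  have h3 : |Δ * (ϑ * Δ / 2 * b - 1)| ≤ Δ * (1 + ϑ * Δ) := by
    rw [abs_mul, abs_of_pos hΔ]
    gcongr
    have h4 : ϑ * Δ / 2 * b ≤ ϑ * Δ / 2 * 1 := by gcongr
    have h6 : 0 ≤ ϑ * Δ / 2 * b := by positivity
    have h7 : 0 < ϑ * Δ := mul_pos hϑ hΔ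
    rw [abs_le]
    constructor <;> linarith
  calc _ ≤ |(k : ℝ)| / ϑ + Δ * (1 + ϑ * Δ) * 1 := by
        refine (abs_add_le _ _).trans (add_le_add (abs_of_nonneg (by positivity)).le ?_)
        rw [mul_one]; exact h3
    _ ≤ 1 / ϑ * Real.exp |(k : ℝ)| + Δ * (1 + ϑ * Δ) * Real.exp |(k : ℝ)| := by
        gcongr
        rw [div_eq_inv_mul, one_div]
        gcongr
        linarith
    _ = _ := by ring

lemma IsModel.information_pos (h : IsModel P ϑ N ε) (hϑ : 0 < ϑ) {T Δ : ℝ} (hT : 0 < T)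
    (hΔ : 0 < Δ) : 0 < information P (compound N ε) ϑ T Δ := by
  have := h.isProbabilityMeasure
  have hm := Measure.isProbabilityMeasure_map (h.measurable_compound Δ.toNNReal).aemeasurable
    (μ := P)
  rw [information_eq h.measurable_compound _ _ hΔ]
  have := integral_score_sq_pos hϑ hΔ (h.measureReal_compound hϑ hΔ) (h.integrable_score_sq hϑ hΔ)
  positivity

lemma information_eq_mul {P : Measure Ω} {X : ℝ≥0 → Ω → ℤ} (ϑ T Δ : ℝ) :
    information P X ϑ T Δ = T * information P X ϑ 1 Δ := by
  simp only [information]; ring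

end Model

/-! ### LAN for the discrete observation. -/

section LAN

variable {Ω : Type*} [MeasurableSpace Ω] {Θ : Set ℝ} {P : ℝ → Measure Ω}
  {N : ℝ → ℝ≥0 → Ω → ℕ} {ε : ℝ → ℕ → Ω → ℤ} {Δ : ℝ → ℝ}

theorem isLAN_observationLaw (hΘ_pos : Θ ⊆ Set.Ioi 0)
    (hmodel : ∀ ϑ ∈ Θ, IsModel (P ϑ) ϑ (N ϑ) (ε ϑ))
    (hΔ : ∀ T, 0 < T → 0 < Δ T) (hmicro : Tendsto Δ atTop (𝓝 0)) {ϑ : ℝ} (hϑΘ : ϑ ∈ Θ) :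
    IsLAN (fun T ϑ' => observationLaw (P ϑ') (compound (N ϑ') (ε ϑ')) T (Δ T)) Θ ϑ
      (fun T => information (P ϑ) (compound (N ϑ) (ε ϑ)) ϑ T (Δ T)) := by
  have hϑ : 0 < ϑ := hΘ_pos hϑΘ
  have hM := hmodel ϑ hϑΘ
  have hP := hM.isProbabilityMeasure
  have hκp : ∀ t, IsProbabilityMeasure ((P ϑ).map (compound (N ϑ) (ε ϑ) t)) := fun t =>
    Measure.isProbabilityMeasure_map (hM.measurable_compound t).aemeasurable
  have hQ : ∀ T, IsProbabilityMeasure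
      (observationLaw (P ϑ) (compound (N ϑ) (ε ϑ)) T (Δ T)) := fun T =>
    isProbabilityMeasure_observationLaw hM.measurable_compound T (Δ T)
  have hκ : ∀ T, 0 < T → ∀ k, ((P ϑ).map (compound (N ϑ) (ε ϑ) (Δ T).toNNReal)).real {k} =
      skellamProb (ϑ * Δ T) k := fun T hT => hM.measureReal_compound hϑ (hΔ T hT)
  set I : ℝ → ℝ := fun T => information (P ϑ) (compound (N ϑ) (ε ϑ)) ϑ T (Δ T) with hIdef
  have hI : ∀ T, 0 < T → 0 < I T := fun T hT => hM.information_pos hϑ hT (hΔ T hT)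
  have hDp := tendsto_nhdsGT_zero_of_pos hΔ hmicro
  have hIT : Tendsto (fun T => T / I T) atTop (𝓝 ϑ) := by
    have h1 := (hM.tendsto_information hϑ hDp).inv₀ (one_div_pos.mpr hϑ).ne'
    rw [one_div, inv_inv] at h1
    refine h1.congr' ?_
    filter_upwards [eventually_gt_atTop 0] with T hT
    simp only [hIdef]
    rw [information_eq_mul ϑ T, div_mul_eq_div_div, div_self hT.ne', one_div]
  have hlaw : ∀ T, 0 < T →
      (observationLaw (P ϑ) (compound (N ϑ) (ε ϑ)) T (Δ T)).map increments =
        Measure.pi fun _ => (P ϑ).map (compound (N ϑ) (ε ϑ) (Δ T).toNNReal) := fun T hT =>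
    hM.map_increments_observationLaw hϑ T (hΔ T hT)
  refine ⟨hI, hQ, fun T z => (√(I T))⁻¹ * ∑ j, score (Δ T) ϑ (increments z j),
    fun T => measurable_of_countable _, ?_, fun v => ?_⟩
  · refine tendstoInDistribution_gaussian (fun T => measurable_of_countable _) fun s => ?_
    refine (tendsto_integral_exp_sum_score
      (κ := fun T => (P ϑ).map (compound (N ϑ) (ε ϑ) (Δ T).toNNReal)) hϑ hΔ hmicro hκ hI hIT s).congr' ?_
    filter_upwards [eventually_gt_atTop 0] with T hT
    rw [← hlaw T hT, integral_map (measurable_of_countable _).aemeasurable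
      (measurable_of_countable _).aestronglyMeasurable]
  -- The remainder is whatever makes the likelihood formula exact. It is written with `skellamProb`,
  -- so it is defined even when the shifted parameter leaves `Θ`, and its convergence needs no
  -- membership.
  · refine ⟨fun T z => ∑ j, (Real.log (skellamProb ((ϑ + v / √(I T)) * Δ T) (increments z j)) -
      Real.log (skellamProb (ϑ * Δ T) (increments z j))) -
      v * ((√(I T))⁻¹ * ∑ j, score (Δ T) ϑ (increments z j)) + v ^ 2 / 2,
      fun T => measurable_of_countable _, fun T hT hmem => ?_, fun δ hδ => ?_⟩
    · have hϑ' : 0 < ϑ + v / √(I T) := hΘ_pos hmem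
      have hM' := hmodel _ hmem
      have hP' := hM'.isProbabilityMeasure
      have hQ' := isProbabilityMeasure_observationLaw (P := P (ϑ + v / √(I T))) hM'.measurable_compound T (Δ T)
      have hpos : ∀ z, 0 < (observationLaw (P ϑ) (compound (N ϑ) (ε ϑ)) T (Δ T)).real {z} := by
        intro z
        rw [hM.measureReal_observationLaw_singleton hϑ T (hΔ T hT)]
        exact Finset.prod_pos fun j _ => skellamProb_pos (mul_pos hϑ (hΔ T hT)) _
      obtain ⟨hac, hrn⟩ := rnDeriv_toReal_of_countable (μ := observationLaw (P (ϑ + v / √(I T)))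
        (compound (N (ϑ + v / √(I T))) (ε (ϑ + v / √(I T)))) T (Δ T)) hpos
      refine ⟨hac, ae_of_all _ fun z => ?_⟩
      rw [hrn, hM.measureReal_observationLaw_singleton hϑ T (hΔ T hT),
        hM'.measureReal_observationLaw_singleton hϑ' T (hΔ T hT), ← Finset.prod_div_distrib]
      have e : ∀ a b c : ℝ, a - b + (c - a + b) = c := fun a b c => by ring
      rw [e, Real.exp_sum]
      refine Finset.prod_congr rfl fun j _ => ?_
      rw [Real.exp_sub, Real.exp_log (skellamProb_pos (mul_pos hϑ' (hΔ T hT)) _),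
        Real.exp_log (skellamProb_pos (mul_pos hϑ (hΔ T hT)) _)]
    · have hu := tendsto_local hI hIT v
      have huT := tendsto_local_sq_mul hI hIT v
      set u : ℝ → ℝ := fun T => v / √(I T) with hudef
      have hx : Tendsto (fun T => u T / ϑ) atTop (𝓝 0) := by simpa using hu.div_const ϑ
      have hxT : Tendsto (fun T => (u T / ϑ) ^ 2 * T) atTop (𝓝 (v ^ 2 / ϑ)) := by
        have := huT.div_const (ϑ ^ 2)
        rw [show v ^ 2 * ϑ / ϑ ^ 2 = v ^ 2 / ϑ by field_simp] at this
        refine this.congr fun T => ?_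
        ring
      have hLLN := tendsto_integral_sum_abs_sub_sq
        (κ := fun T => (P ϑ).map (compound (N ϑ) (ε ϑ) (Δ T).toNNReal)) hϑ hΔ hmicro hκ hx hxT
      rw [div_mul_cancel₀ _ hϑ.ne'] at hLLN
      -- `Z` is the law-of-large-numbers error. The two terms of `g` bound the cubic error of the
      -- logarithm and the sum of at most `T / Δ` remainders of size `u² Δ² (ϑ² + 1)`.
      refine tendsto_measure_of_abs_le
        (g := fun T => 2 * v ^ 2 * |u T / ϑ| + u T ^ 2 * T * Δ T * (ϑ ^ 2 + 1))
        (Z := fun T z => (u T / ϑ) ^ 2 * ∑ j, |((increments z j : ℤ) : ℝ)| - v ^ 2)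
        ?_ ?_ ?_ ?_ hδ
      · have huϑ : ∀ᶠ T in atTop, |u T / ϑ| ≤ 1 / 2 := by
          have := hx.abs
          rw [abs_zero] at this
          exact this.eventually (ge_mem_nhds (by norm_num))
        filter_upwards [eventually_gt_atTop 0, huϑ, eventually_pos_and_le_one hDp]
          with T hT hT2 hd z
        have hT3 : |u T| ≤ ϑ / 2 := by
          rw [abs_div, abs_of_pos hϑ, div_le_iff₀ hϑ] at hT2
          linarith
        have hT4 : 0 < ϑ + u T := by linarith [(abs_le.mp hT3).1]
        set A := ∑ j, |((increments z j : ℤ) : ℝ)| with hA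
        have hquad := abs_mul_log_one_add_sub_add_le hT2 A (v ^ 2)
        have hrest : |∑ j, (Real.log (skellamProb ((ϑ + u T) * Δ T) (increments z j)) -
            Real.log (skellamProb (ϑ * Δ T) (increments z j)) -
            u T * score (Δ T) ϑ (increments z j) - |((increments z j : ℤ) : ℝ)| *
              (Real.log (1 + u T / ϑ) - u T / ϑ))| ≤ u T ^ 2 * T * Δ T * (ϑ ^ 2 + 1) := by
          refine (Finset.abs_sum_le_sum_abs _ _).trans ?_
          refine (Finset.sum_le_sum fun j _ => abs_log_skellamProb_sub_le hϑ hT4 (by linarith)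
            hd.1 hd.2 (increments z j)).trans ?_
          rw [Finset.sum_const, Finset.card_univ, Fintype.card_fin, nsmul_eq_mul]
          have hfl := Nat.floor_le (div_pos hT hd.1).le
          rw [le_div_iff₀ hd.1] at hfl
          calc _ = (⌊T / Δ T⌋₊ * Δ T) * (u T ^ 2 * Δ T * (ϑ ^ 2 + 1)) := by ring
            _ ≤ T * (u T ^ 2 * Δ T * (ϑ ^ 2 + 1)) := by
              have := hd.1
              gcongr
            _ = _ := by ring
        simp only [Finset.sum_sub_distrib, ← Finset.mul_sum, ← Finset.sum_mul] at hrest ⊢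
        rw [← hA] at hrest
        have e : v * ((√(I T))⁻¹ * ∑ j, score (Δ T) ϑ (increments z j)) =
            u T * ∑ j, score (Δ T) ϑ (increments z j) := by simp only [hudef]; ring
        rw [e]
        have hsplit : ∀ a b c d w R : ℝ, |a - b - c - d| ≤ R →
            |a - b - c + w| ≤ |d + w| + R := by
          intro a b c d w R h
          calc |a - b - c + w| = |(d + w) + (a - b - c - d)| := by congr 1; ring
            _ ≤ |d + w| + R := (abs_add_le _ _).trans (by gcongr)
        refine (hsplit _ _ _ _ _ _ hrest).trans ?_
        rw [abs_of_nonneg (sq_nonneg v)] at hquad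
        linarith
      · have h1 := (hx.abs.const_mul (2 * v ^ 2)).add
          ((huT.mul hmicro).mul_const (ϑ ^ 2 + 1))
        simpa using h1
      · filter_upwards [eventually_gt_atTop 0] with T hT
        have hm := (memLp_sum_abs (mul_pos hϑ (hΔ T hT)) (hκ T hT) ⌊T / Δ T⌋₊).const_mul
          ((u T / ϑ) ^ 2)
        have hm2 := (hm.sub (memLp_const (v ^ 2))).integrable_sq
        rw [← hlaw T hT] at hm2
        exact hm2.comp_measurable (measurable_of_countable _)
      · refine hLLN.congr' ?_
        filter_upwards [eventually_gt_atTop 0] with T hT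
        rw [← hlaw T hT, integral_map (measurable_of_countable _).aemeasurable
          (measurable_of_countable _).aestronglyMeasurable]

end LAN

/-! ### Poisson mean and variance. -/

section PoissonMoments

lemma hasSum_poisson_mul_id (r : ℝ≥0) :
    HasSum (fun n : ℕ => Real.exp (-r) * r ^ n / n.factorial * n) r := by
  rw [← hasSum_nat_add_iff' 1]
  simp only [Finset.sum_range_one, CharP.cast_eq_zero, mul_zero, sub_zero]
  have h := (hasSum_one_poissonMeasure r).mul_left (r : ℝ)
  rw [mul_one] at h
  refine h.congr_fun fun n => ?_
  rw [Nat.factorial_succ, pow_succ]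
  have := Nat.factorial_pos n
  push_cast
  field_simp

lemma hasSum_poisson_mul_descending (r : ℝ≥0) :
    HasSum (fun n : ℕ => Real.exp (-r) * r ^ n / n.factorial * (n * (n - 1))) ((r : ℝ) ^ 2) := by
  rw [← hasSum_nat_add_iff' 2]
  simp only [Finset.sum_range_succ, Finset.sum_range_zero, CharP.cast_eq_zero, zero_mul, mul_zero,
    Nat.cast_one, sub_self, add_zero, sub_zero]
  have h := (hasSum_one_poissonMeasure r).mul_left ((r : ℝ) ^ 2)
  rw [mul_one] at h
  refine h.congr_fun fun n => ?_
  rw [Nat.factorial_succ, Nat.factorial_succ, pow_add]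
  have := Nat.factorial_pos n
  push_cast
  field_simp
  ring

lemma hasSum_poisson_mul_sub_sq (r : ℝ≥0) :
    HasSum (fun n : ℕ => Real.exp (-r) * r ^ n / n.factorial * ((n : ℝ) - r) ^ 2) r := by
  have h := ((hasSum_poisson_mul_descending r).add
    ((hasSum_poisson_mul_id r).mul_left (1 - 2 * (r : ℝ)))).add
    ((hasSum_one_poissonMeasure r).mul_left ((r : ℝ) ^ 2))
  convert! h using 1
  · ext n; ring
  · ring

lemma integrable_poisson_sub_sq (r : ℝ≥0) :
    Integrable (fun n : ℕ => ((n : ℝ) - r) ^ 2) (poissonMeasure r) := by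
  rw [integrable_poissonMeasure_iff]
  simpa using (hasSum_poisson_mul_sub_sq r).summable

lemma integral_poisson_sub_sq (r : ℝ≥0) :
    ∫ n : ℕ, ((n : ℝ) - r) ^ 2 ∂(poissonMeasure r) = r := by
  rw [integral_poissonMeasure]
  exact (hasSum_poisson_mul_sub_sq r).tsum_eq

end PoissonMoments

/-! ### Change of intensity on path space. -/

lemma sum_fin_succ_sub_castSucc {n : ℕ} (f : Fin (n + 1) → ℝ) :
    ∑ i : Fin n, (f i.succ - f i.castSucc) = f (Fin.last n) - f 0 := by
  induction n with
  | zero => simp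
  | succ n ih =>
    rw [Fin.sum_univ_castSucc]
    have := ih (fun i => f i.castSucc)
    simp only [Fin.succ_castSucc, Fin.castSucc_zero] at this ⊢
    rw [this, Fin.succ_last]
    ring

/-- The Poisson likelihood ratio, with exponent linear in `d` and `δ` so that products over
increments telescope. For negative `d` both masses vanish. -/
lemma poisson_int_real_singleton_change {ϑ ϑ' : ℝ} (hϑ : 0 < ϑ) (hϑ' : 0 < ϑ') (δ : ℝ≥0) (d : ℤ) :
    ((poissonMeasure (ϑ'.toNNReal * δ)).map (fun n : ℕ => (n : ℤ))).real {d} =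
      Real.exp (d * Real.log (ϑ' / ϑ) - (ϑ' - ϑ) * δ) *
        ((poissonMeasure (ϑ.toNNReal * δ)).map (fun n : ℕ => (n : ℤ))).real {d} := by
  rw [map_measureReal_apply measurable_from_top (measurableSet_singleton d),
    map_measureReal_apply measurable_from_top (measurableSet_singleton d)]
  by_cases hd : ∃ m : ℕ, (m : ℤ) = d
  · obtain ⟨m, rfl⟩ := hd
    have : (fun n : ℕ => (n : ℤ)) ⁻¹' {(m : ℤ)} = {m} := by ext n; simp
    rw [this, poissonMeasure_real_singleton, poissonMeasure_real_singleton]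
    push_cast
    rw [Real.coe_toNNReal _ hϑ.le, Real.coe_toNNReal _ hϑ'.le, sub_eq_add_neg, Real.exp_add,
      mul_comm (m : ℝ), Real.exp_mul, Real.exp_log (by positivity), Real.rpow_natCast,
      show -(ϑ' * (δ : ℝ)) = -((ϑ' - ϑ) * δ) + -(ϑ * δ) by ring, Real.exp_add,
      show ϑ' * (δ : ℝ) = ϑ' / ϑ * (ϑ * δ) by field_simp, mul_pow]
    ring
  · have : (fun n : ℕ => (n : ℤ)) ⁻¹' {d} = ∅ := by
      ext n
      simp only [Set.mem_preimage, Set.mem_singleton_iff, Set.mem_empty_iff_false, iff_false]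
      exact fun h => hd ⟨n, h⟩
    rw [this]
    simp

section Paths

variable {Ω : Type*} [MeasurableSpace Ω] {P : Measure Ω} {ϑ : ℝ} {N : ℝ≥0 → Ω → ℕ}

lemma IsPoissonProcess.measureReal_eq (h : IsPoissonProcess P ϑ N) {n : ℕ}
    {t : Fin (n + 1) → ℝ≥0} (ht : Monotone t) (ht0 : t 0 = 0) {a : Fin (n + 1) → ℕ}
    (ha : a 0 = 0) :
    P.real {ω | ∀ i, N (t i) ω = a i} = ∏ i : Fin n,
      ((poissonMeasure (ϑ.toNNReal * (t i.succ - t i.castSucc))).map (fun n : ℕ => (n : ℤ))).real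
        {(a i.succ : ℤ) - a i.castSucc} := by
  have hind := h.indep_increments n t ht
  have hprob := hind.isProbabilityMeasure
  have hm : ∀ i : Fin n,
      Measurable (fun ω => (N (t i.succ) ω : ℤ) - (N (t i.castSucc) ω : ℤ)) := fun i =>
    (measurable_from_top.comp (h.measurable _)).sub (measurable_from_top.comp (h.measurable _))
  have hpi := hind.map_fun_eq_pi_map fun i => (hm i).aemeasurable
  have hset : {ω | ∀ i, N (t i) ω = a i} =ᵐ[P]
      ((fun ω (i : Fin n) => (N (t i.succ) ω : ℤ) - (N (t i.castSucc) ω : ℤ)) ⁻¹'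
        {fun i => (a i.succ : ℤ) - a i.castSucc} : Set Ω) := by
    filter_upwards [h.start_zero] with ω h0
    apply propext
    change (∀ i, N (t i) ω = a i) ↔ (fun i : Fin n => (N (t i.succ) ω : ℤ) - N (t i.castSucc) ω) =
      fun i => (a i.succ : ℤ) - a i.castSucc
    refine ⟨fun H => by ext i; rw [H, H], fun H i => ?_⟩
    induction i using Fin.induction with
    | zero => rw [ht0, h0, ha]
    | succ i ih =>
      have := congrFun H i
      omega
  rw [measureReal_congr hset, ← map_measureReal_apply (measurable_pi_lambda _ hm)
    (measurableSet_singleton _), hpi, measureReal_def]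
  have : ∀ i : Fin n, IsProbabilityMeasure
      (P.map fun ω => (N (t i.succ) ω : ℤ) - (N (t i.castSucc) ω : ℤ)) := fun i =>
    Measure.isProbabilityMeasure_map (hm i).aemeasurable
  rw [Measure.pi_singleton, ENNReal.toReal_prod]
  refine Finset.prod_congr rfl fun i _ => ?_
  rw [(h.increment_law _ _ (ht (Fin.castSucc_lt_succ (i := i)).le)).map_eq, measureReal_def]

lemma IsPoissonProcess.measureReal_eq_zero (h : IsPoissonProcess P ϑ N) {n : ℕ}
    {t : Fin (n + 1) → ℝ≥0} (ht0 : t 0 = 0) {a : Fin (n + 1) → ℕ}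
    (ha : a 0 ≠ 0) : P.real {ω | ∀ i, N (t i) ω = a i} = 0 := by
  rw [measureReal_def, ENNReal.toReal_eq_zero_iff]
  left
  have := h.start_zero
  rw [ae_iff] at this
  refine measure_mono_null (fun ω hω (h0 : N 0 ω = 0) => ha ?_) this
  rw [← hω 0, ht0, h0]

lemma IsPoissonProcess.measureReal_change {Ω' : Type*} [MeasurableSpace Ω'] {P' : Measure Ω'}
    {ϑ' : ℝ} {N' : ℝ≥0 → Ω' → ℕ} (h : IsPoissonProcess P ϑ N) (h' : IsPoissonProcess P' ϑ' N')
    (hϑ : 0 < ϑ) (hϑ' : 0 < ϑ') {n : ℕ} {t : Fin (n + 1) → ℝ≥0} (ht : Monotone t) (ht0 : t 0 = 0)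
    (a : Fin (n + 1) → ℕ) :
    P'.real {ω | ∀ i, N' (t i) ω = a i} =
      Real.exp (a (Fin.last n) * Real.log (ϑ' / ϑ) - (ϑ' - ϑ) * t (Fin.last n)) *
        P.real {ω | ∀ i, N (t i) ω = a i} := by
  by_cases ha : a 0 = 0
  · rw [h.measureReal_eq ht ht0 ha, h'.measureReal_eq ht ht0 ha]
    simp_rw [poisson_int_real_singleton_change hϑ hϑ']
    rw [Finset.prod_mul_distrib, ← Real.exp_sum, Finset.sum_sub_distrib, ← Finset.sum_mul,
      ← Finset.mul_sum]
    have h1 := sum_fin_succ_sub_castSucc (fun i => (a i : ℝ))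
    have h2 := sum_fin_succ_sub_castSucc (fun i => (t i : ℝ))
    have h3 : ∀ i : Fin n, ((t i.succ - t i.castSucc : ℝ≥0) : ℝ) = t i.succ - t i.castSucc :=
      fun i => NNReal.coe_sub (ht (Fin.castSucc_lt_succ (i := i)).le)
    push_cast
    simp_rw [h3]
    rw [h1, h2, ha, ht0]
    simp
  · rw [h.measureReal_eq_zero ht0 ha, h'.measureReal_eq_zero ht0 ha, mul_zero]

/-- The value at time `T` of a path on `[0, T]`. -/
noncomputable def terminal (T : ℝ) (x : {t : ℝ≥0 // (t : ℝ) ≤ T} → ℕ) : ℝ :=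
  if h : 0 ≤ T then x ⟨T.toNNReal, (Real.coe_toNNReal T h).le⟩ else 0

lemma measurable_terminal (T : ℝ) : Measurable (terminal T) := by
  unfold terminal
  split_ifs with h
  · exact measurable_from_top.comp (measurable_pi_apply _)
  · exact measurable_const

lemma measurable_path (hN : ∀ t, Measurable (N t)) (T : ℝ) :
    Measurable (fun ω (t : {t : ℝ≥0 // (t : ℝ) ≤ T}) => N t ω) :=
  measurable_pi_lambda _ fun _ => hN _

lemma isProbabilityMeasure_pathLaw [IsProbabilityMeasure P] (hN : ∀ t, Measurable (N t)) (T : ℝ) :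
    IsProbabilityMeasure (pathLaw P N T) :=
  Measure.isProbabilityMeasure_map (measurable_path hN T).aemeasurable

/-- Adjoin the endpoints `0` and `T` to the finite set and list it in order: `0` anchors the
increments, and `T` makes the density a function of the last coordinate. -/
lemma exists_monotone_enumeration {T : ℝ} (hT : 0 ≤ T) (I : Finset {t : ℝ≥0 // (t : ℝ) ≤ T}) :
    ∃ (n : ℕ) (t : Fin (n + 1) → {t : ℝ≥0 // (t : ℝ) ≤ T}), Monotone t ∧ (t 0 : ℝ≥0) = 0 ∧
      t (Fin.last n) = ⟨T.toNNReal, (Real.coe_toNNReal T hT).le⟩ ∧ ∀ i ∈ I, ∃ j, t j = i := by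
  classical
  set z : {t : ℝ≥0 // (t : ℝ) ≤ T} := ⟨0, hT⟩ with hz
  set e : {t : ℝ≥0 // (t : ℝ) ≤ T} := ⟨T.toNNReal, (Real.coe_toNNReal T hT).le⟩ with he
  have hzmin : ∀ i, z ≤ i := fun i => Subtype.coe_le_coe.mp (by simp [hz])
  have hemax : ∀ i, i ≤ e := fun i => Subtype.coe_le_coe.mp (NNReal.le_toNNReal_of_coe_le i.2)
  set J := insert z (insert e I) with hJ
  obtain ⟨n, hn⟩ : ∃ n, J.card = n + 1 :=
    ⟨J.card - 1, (Nat.succ_pred_eq_of_pos (Finset.card_pos.mpr ⟨z, by simp [hJ]⟩)).symm⟩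
  have hmem : ∀ i ∈ J, ∃ j, J.orderEmbOfFin hn j = i := by
    intro i hi
    have : i ∈ Set.range (J.orderEmbOfFin hn) := by rw [Finset.range_orderEmbOfFin]; exact hi
    exact this
  refine ⟨n, J.orderEmbOfFin hn, (J.orderEmbOfFin hn).monotone, ?_, ?_, fun i hi =>
    hmem i (by simp [hJ, hi])⟩
  · obtain ⟨j, hj⟩ := hmem z (by simp [hJ])
    have : J.orderEmbOfFin hn 0 = z :=
      le_antisymm (hj ▸ (J.orderEmbOfFin hn).monotone (Fin.zero_le j)) (hzmin _)
    rw [this]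
  · obtain ⟨j, hj⟩ := hmem e (by simp [hJ])
    exact le_antisymm (hemax _) (hj ▸ (J.orderEmbOfFin hn).monotone (Fin.le_last j))

/-- On any finite grid containing `0` and `T` the likelihood ratio telescopes to a function of the
value at `T`. The two measures thus agree on all cylinders, a π-system generating the product
σ-algebra. -/
theorem IsPoissonProcess.pathLaw_eq_withDensity {Ω' : Type*} [MeasurableSpace Ω']
    {P' : Measure Ω'} [IsProbabilityMeasure P] [IsProbabilityMeasure P']
    {ϑ' : ℝ} {N' : ℝ≥0 → Ω' → ℕ} (h : IsPoissonProcess P ϑ N) (h' : IsPoissonProcess P' ϑ' N')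
    (hϑ : 0 < ϑ) (hϑ' : 0 < ϑ') {T : ℝ} (hT : 0 ≤ T) :
    pathLaw P' N' T = (pathLaw P N T).withDensity fun x =>
      ENNReal.ofReal (Real.exp (terminal T x * Real.log (ϑ' / ϑ) - (ϑ' - ϑ) * T)) := by
  have hp := isProbabilityMeasure_pathLaw (P := P) h.measurable T
  have hp' := isProbabilityMeasure_pathLaw (P := P') h'.measurable T
  set f : ({t : ℝ≥0 // (t : ℝ) ≤ T} → ℕ) → ℝ≥0∞ := fun x =>
      ENNReal.ofReal (Real.exp (terminal T x * Real.log (ϑ' / ϑ) - (ϑ' - ϑ) * T)) with hf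
  have key : ∀ (n : ℕ) (t : Fin (n + 1) → {t : ℝ≥0 // (t : ℝ) ≤ T}), Monotone t →
      (t 0 : ℝ≥0) = 0 → t (Fin.last n) = ⟨T.toNNReal, (Real.coe_toNNReal T hT).le⟩ →
      (pathLaw P' N' T).map (fun x i => x (t i)) =
        ((pathLaw P N T).withDensity f).map (fun x i => x (t i)) := by
    intro n t ht ht0 htl
    have hev : Measurable (fun (x : {t : ℝ≥0 // (t : ℝ) ≤ T} → ℕ) i => x (t i)) :=
      measurable_pi_lambda _ fun i => measurable_pi_apply _
    refine Measure.ext_of_singleton fun a => ?_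
    have hms : MeasurableSet ((fun (x : {t : ℝ≥0 // (t : ℝ) ≤ T} → ℕ) i => x (t i)) ⁻¹' {a}) :=
      hev (measurableSet_singleton a)
    rw [Measure.map_apply hev (measurableSet_singleton a),
      Measure.map_apply hev (measurableSet_singleton a), withDensity_apply _ hms]
    have hconst : ∀ x ∈ (fun (x : {t : ℝ≥0 // (t : ℝ) ≤ T} → ℕ) i => x (t i)) ⁻¹' {a}, f x =
        ENNReal.ofReal (Real.exp (a (Fin.last n) * Real.log (ϑ' / ϑ) - (ϑ' - ϑ) * T)) := by
      intro x hx
      have hx' : (fun i => x (t i)) = a := hx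
      have := congrFun hx' (Fin.last n)
      simp only [htl] at this
      simp only [hf, terminal, dif_pos hT, this]
    rw [setLIntegral_congr_fun hms hconst, setLIntegral_const, pathLaw, pathLaw,
      Measure.map_apply (measurable_path h.measurable T) hms,
      Measure.map_apply (measurable_path h'.measurable T) hms]
    have hch := h.measureReal_change h' hϑ hϑ' (t := fun i => (t i : ℝ≥0))
      (fun i j hij => ht hij) ht0 a
    have htT : ((t (Fin.last n) : ℝ≥0) : ℝ) = T := by rw [htl]; exact Real.coe_toNNReal T hT
    rw [htT] at hch
    rw [← ofReal_measureReal (μ := P'), ← ofReal_measureReal (μ := P),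
      ← ENNReal.ofReal_mul (Real.exp_pos _).le]
    congr 1
    refine Eq.trans ?_ (hch.trans ?_)
    · congr 1; ext ω; simp [funext_iff]
    · congr 2; ext ω; simp [funext_iff]
  refine ext_of_generate_finite (measurableCylinders fun _ => ℕ)
    generateFrom_measurableCylinders.symm isPiSystem_measurableCylinders (fun s hs => ?_) ?_
  · obtain ⟨I, S, hS, rfl⟩ := (mem_measurableCylinders s).mp hs
    obtain ⟨n, t, ht, ht0, htl, hI⟩ := exists_monotone_enumeration hT I
    choose! idx hidx using hI
    have hev : Measurable (fun (x : {t : ℝ≥0 // (t : ℝ) ≤ T} → ℕ) i => x (t i)) :=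
      measurable_pi_lambda _ fun i => measurable_pi_apply _
    have hcyl : cylinder I S = (fun (x : {t : ℝ≥0 // (t : ℝ) ≤ T} → ℕ) i => x (t i)) ⁻¹'
        {a | (fun i : I => a (idx i)) ∈ S} := by
      ext x
      rw [mem_cylinder, Set.mem_preimage, Set.mem_ofPred_eq]
      have : (fun i : I => x (t (idx i))) = I.restrict x := by
        ext i
        rw [hidx i i.2]
        rfl
      rw [this]
    have hm : MeasurableSet {a : Fin (n + 1) → ℕ | (fun i : I => a (idx i)) ∈ S} :=
      (Set.to_countable _).measurableSet
    rw [hcyl, ← Measure.map_apply hev hm, ← Measure.map_apply hev hm, key n t ht ht0 htl]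
  -- Equality of total masses is read off from the grid that enumerates only the endpoints.
  · obtain ⟨n, t, ht, ht0, htl, hI⟩ := exists_monotone_enumeration hT ∅
    have hev : Measurable (fun (x : {t : ℝ≥0 // (t : ℝ) ≤ T} → ℕ) i => x (t i)) :=
      measurable_pi_lambda _ fun i => measurable_pi_apply _
    have := congrArg (fun m => m Set.univ) (key n t ht ht0 htl)
    simpa [Measure.map_apply hev] using this

lemma IsPoissonProcess.map_terminal (h : IsPoissonProcess P ϑ N) {T : ℝ} (hT : 0 ≤ T) :
    (pathLaw P N T).map (terminal T) =
      (poissonMeasure (ϑ.toNNReal * T.toNNReal)).map (fun n : ℕ => (n : ℝ)) := by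
  rw [pathLaw, Measure.map_map (measurable_terminal T) (measurable_path h.measurable T)]
  have hl := h.increment_law 0 T.toNNReal zero_le
  rw [tsub_zero] at hl
  have h2 : P.map (fun ω => ((((N T.toNNReal ω : ℤ) - (N 0 ω : ℤ) : ℤ)) : ℝ)) =
      (poissonMeasure (ϑ.toNNReal * T.toNNReal)).map (fun n : ℕ => (n : ℝ)) := by
    have := congrArg (Measure.map (fun k : ℤ => (k : ℝ))) hl.map_eq
    rw [Measure.map_map measurable_from_top measurable_from_top,
      AEMeasurable.map_map_of_aemeasurable measurable_from_top.aemeasurable hl.aemeasurable] at this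
    convert! this using 2
  rw [← h2]
  refine Measure.map_congr ?_
  filter_upwards [h.start_zero] with ω h0
  simp [terminal, dif_pos hT, h0]

end Paths

/-! ### LAN for the observed path. -/

section LAN

variable {Ω : Type*} [MeasurableSpace Ω] {Θ : Set ℝ} {P : ℝ → Measure Ω} {N : ℝ → ℝ≥0 → Ω → ℕ}

theorem isLAN_pathLaw (hΘ_pos : Θ ⊆ Set.Ioi 0) (hP : ∀ ϑ ∈ Θ, IsProbabilityMeasure (P ϑ))
    (hN : ∀ ϑ ∈ Θ, IsPoissonProcess (P ϑ) ϑ (N ϑ)) {ϑ : ℝ} (hϑΘ : ϑ ∈ Θ) :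
    IsLAN (fun T ϑ' => pathLaw (P ϑ') (N ϑ') T) Θ ϑ (fun T => T / ϑ) := by
  have hϑ : 0 < ϑ := hΘ_pos hϑΘ
  have hM := hN ϑ hϑΘ
  have hp := hP ϑ hϑΘ
  have hI : ∀ T, 0 < T → 0 < T / ϑ := fun T hT => div_pos hT hϑ
  have hQ : ∀ T, IsProbabilityMeasure (pathLaw (P ϑ) (N ϑ) T) := fun T =>
    isProbabilityMeasure_pathLaw hM.measurable T
  have hIT : Tendsto (fun T => T / (T / ϑ)) atTop (𝓝 ϑ) := by
    refine tendsto_const_nhds.congr' ?_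
    filter_upwards [eventually_gt_atTop 0] with T hT
    field_simp
  have hlam : ∀ T, 0 < T → ((ϑ.toNNReal * T.toNNReal : ℝ≥0) : ℝ) = ϑ * T := fun T hT => by
    push_cast; rw [Real.coe_toNNReal _ hϑ.le, Real.coe_toNNReal _ hT.le]
  have hξm : ∀ (c : ℝ) T, Measurable fun x => c * (terminal T x - ϑ * T) := fun c T =>
    ((measurable_terminal T).sub_const _).const_mul _
  -- Since `√(T / ϑ) * ϑ = √(ϑ * T)`, this is the standardised Poisson count.
  refine ⟨hI, hQ, fun T x => (√(T / ϑ) * ϑ)⁻¹ * (terminal T x - ϑ * T), fun T => hξm _ T, ?_,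
    fun v => ?_⟩
  · refine tendstoInDistribution_gaussian (fun T => hξm _ T) fun s => ?_
    have hy := (tendsto_local hI hIT s).div_const ϑ
    rw [zero_div] at hy
    have hyT : Tendsto (fun T => ϑ * T * (s / √(T / ϑ) / ϑ) ^ 2) atTop (𝓝 (s ^ 2)) := by
      have := (tendsto_local_sq_mul hI hIT s).div_const ϑ
      rw [mul_div_cancel_right₀ _ hϑ.ne'] at this
      refine this.congr fun T => ?_
      field_simp
    have hlim := (Complex.continuous_exp.tendsto _).comp (tendsto_mul_exp_mul_I_sub hy hyT)
    refine hlim.congr' ?_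
    filter_upwards [eventually_gt_atTop 0] with T hT
    have hy2 : s * (√(T / ϑ) * ϑ)⁻¹ = s / √(T / ϑ) / ϑ := by rw [mul_inv]; ring
    rw [Function.comp_apply]
    generalize s / √(T / ϑ) / ϑ = y at hy2 ⊢
    have e : ∀ x, Complex.exp ((s * ((√(T / ϑ) * ϑ)⁻¹ * (terminal T x - ϑ * T)) : ℝ) * Complex.I) =
        Complex.exp (-(ϑ * T * y * Complex.I)) *
          Complex.exp (y * (terminal T x : ℂ) * Complex.I) := by
      intro x
      rw [← Complex.exp_add, ← mul_assoc, hy2]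
      congr 1
      push_cast
      ring
    simp_rw [e]
    rw [integral_const_mul]
    have hcf : ∫ x, Complex.exp (y * (terminal T x : ℂ) * Complex.I) ∂(pathLaw (P ϑ) (N ϑ) T) =
        Complex.exp ((ϑ * T : ℝ) * (Complex.exp (y * Complex.I) - 1)) := by
      rw [← hlam T hT, ← charFun_map_cast_poissonMeasure, ← hM.map_terminal hT.le,
        charFun_apply_real, integral_map (measurable_terminal T).aemeasurable (by fun_prop)]
    rw [hcf, ← Complex.exp_add]
    congr 1
    push_cast
    ring
  · have hu := tendsto_local hI hIT v
    have huT := tendsto_local_sq_mul hI hIT v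
    -- With `x = u / ϑ`, the log-likelihood ratio is `N_T * log (1 + x) - u * T` and `v * ξ = x *
    -- N_T - u * T`, so this remainder is exact.
    refine ⟨fun T x => terminal T x * (Real.log (1 + v / √(T / ϑ) / ϑ) - v / √(T / ϑ) / ϑ) +
      v ^ 2 / 2, fun T => ((measurable_terminal T).mul_const _).add_const _,
      fun T hT hmem => ?_, fun δ hδ => ?_⟩
    · have hϑ' : 0 < ϑ + v / √(T / ϑ) := hΘ_pos hmem
      have hp' := hP _ hmem
      have hd := hM.pathLaw_eq_withDensity (hN _ hmem) hϑ hϑ' hT.le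
      have hfm : Measurable fun x => ENNReal.ofReal (Real.exp (terminal T x *
          Real.log ((ϑ + v / √(T / ϑ)) / ϑ) - (ϑ + v / √(T / ϑ) - ϑ) * T)) :=
        ((((measurable_terminal T).mul_const _).sub_const _).exp).ennreal_ofReal
      simp only
      refine ⟨hd ▸ withDensity_absolutelyContinuous _ _, ?_⟩
      have hrn := Measure.rnDeriv_withDensity (pathLaw (P ϑ) (N ϑ) T) hfm
      rw [← hd] at hrn
      filter_upwards [hrn] with x hx
      rw [hx, ENNReal.toReal_ofReal (Real.exp_pos _).le, add_div, div_self hϑ.ne']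
      congr 1
      have hs : 0 < √(T / ϑ) := Real.sqrt_pos.mpr (hI T hT)
      field_simp
      ring
    · set u : ℝ → ℝ := fun T => v / √(T / ϑ) with hudef
      have hx : Tendsto (fun T => u T / ϑ) atTop (𝓝 0) := by simpa using hu.div_const ϑ
      have hxv : ∀ T, 0 < T → (u T / ϑ) ^ 2 * (ϑ * T) = v ^ 2 := by
        intro T hT
        simp only [hudef]
        rw [div_pow, div_pow, Real.sq_sqrt (hI T hT).le]
        field_simp
      have hmap : ∀ T, 0 < T → ∀ g : ℝ → ℝ, Measurable g → (Integrable (fun n : ℕ => g n)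
          (poissonMeasure (ϑ.toNNReal * T.toNNReal))) →
          Integrable (fun x => g (terminal T x)) (pathLaw (P ϑ) (N ϑ) T) ∧
          ∫ x, g (terminal T x) ∂(pathLaw (P ϑ) (N ϑ) T) =
            ∫ n : ℕ, g n ∂(poissonMeasure (ϑ.toNNReal * T.toNNReal)) := by
        intro T hT g hg hi
        have e := hM.map_terminal hT.le
        constructor
        · have h1 : Integrable g ((pathLaw (P ϑ) (N ϑ) T).map (terminal T)) := by
            rw [e, integrable_map_measure hg.aestronglyMeasurable .of_discrete]
            exact hi
          exact h1.comp_measurable (measurable_terminal T)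
        · rw [← integral_map (measurable_terminal T).aemeasurable hg.aestronglyMeasurable, e,
            integral_map .of_discrete hg.aestronglyMeasurable]
      have hZ : ∀ T, 0 < T →
          Integrable (fun x => ((u T / ϑ) ^ 2 * terminal T x - v ^ 2) ^ 2)
            (pathLaw (P ϑ) (N ϑ) T) ∧
          ∫ x, ((u T / ϑ) ^ 2 * terminal T x - v ^ 2) ^ 2 ∂(pathLaw (P ϑ) (N ϑ) T) =
            (u T / ϑ) ^ 2 * v ^ 2 := by
        intro T hT
        have e : ∀ y : ℝ, ((u T / ϑ) ^ 2 * y - v ^ 2) ^ 2 =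
            ((u T / ϑ) ^ 2) ^ 2 * (y - (ϑ.toNNReal * T.toNNReal : ℝ≥0)) ^ 2 := by
          intro y
          rw [hlam T hT, ← mul_pow, mul_sub, hxv T hT]
        have hm := hmap T hT (fun y => ((u T / ϑ) ^ 2 * y - v ^ 2) ^ 2) (by fun_prop) (by
          simp_rw [e]
          exact (integrable_poisson_sub_sq _).const_mul _)
        refine ⟨hm.1, hm.2.trans ?_⟩
        simp_rw [e]
        rw [integral_const_mul, integral_poisson_sub_sq, hlam T hT, sq ((u T / ϑ) ^ 2), mul_assoc,
          hxv T hT]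
      refine tendsto_measure_of_abs_le (g := fun T => 2 * v ^ 2 * |u T / ϑ|)
        (Z := fun T x => (u T / ϑ) ^ 2 * terminal T x - v ^ 2) ?_ ?_ ?_ ?_ hδ
      · have huϑ : ∀ᶠ T in atTop, |u T / ϑ| ≤ 1 / 2 := by
          have := hx.abs
          rw [abs_zero] at this
          exact this.eventually (ge_mem_nhds (by norm_num))
        filter_upwards [huϑ] with T hT x
        have := abs_mul_log_one_add_sub_add_le hT (terminal T x) (v ^ 2)
        rw [abs_of_nonneg (sq_nonneg v)] at this
        linarith
      · simpa using hx.abs.const_mul (2 * v ^ 2)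
      · filter_upwards [eventually_gt_atTop 0] with T hT using (hZ T hT).1
      · have h1 := (hx.pow 2).mul_const (v ^ 2)
        rw [zero_pow two_ne_zero, zero_mul] at h1
        refine h1.congr' ?_
        filter_upwards [eventually_gt_atTop 0] with T hT using (hZ T hT).2.symm

end LAN

end AcrossScales

theorem theorem2 {Ω : Type*} [MeasurableSpace Ω]
    (Θ : Set ℝ) (hΘ_pos : Θ ⊆ Set.Ioi 0) (hΘ_int : (interior Θ).Nonempty)
    (P : ℝ → Measure Ω) (N : ℝ → ℝ≥0 → Ω → ℕ) (ε : ℝ → ℕ → Ω → ℤ)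
    (hmodel : ∀ ϑ ∈ Θ, AcrossScales.IsModel (P ϑ) ϑ (N ϑ) (ε ϑ))
    (Δ : ℝ → ℝ) (hΔ : ∀ T, 0 < T → 0 < Δ T ∧ Δ T ≤ T)
    (hmicro : Tendsto Δ atTop (𝓝 0)) :
    ∀ ϑ ∈ Θ,
      AcrossScales.IsLAN
        (fun T ϑ' => AcrossScales.observationLaw (P ϑ')
          (AcrossScales.compound (N ϑ') (ε ϑ')) T (Δ T))
        Θ ϑ
        (fun T => AcrossScales.information (P ϑ)
          (AcrossScales.compound (N ϑ) (ε ϑ)) ϑ T (Δ T)) ∧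
      ((fun T => AcrossScales.information (P ϑ)
          (AcrossScales.compound (N ϑ) (ε ϑ)) ϑ T (Δ T)) ~[atTop] fun T => T / ϑ) ∧
      (∀ T, 0 < T →
        Tendsto (fun δ => AcrossScales.information (P ϑ)
          (AcrossScales.compound (N ϑ) (ε ϑ)) ϑ T δ) (𝓝[>] 0) (𝓝 (T / ϑ))) ∧
      AcrossScales.IsLAN (fun T ϑ' => AcrossScales.pathLaw (P ϑ') (N ϑ') T)
        Θ ϑ (fun T => T / ϑ) := by
  intro ϑ hϑΘ
  have hϑ : 0 < ϑ := hΘ_pos hϑΘ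
  have hM := hmodel ϑ hϑΘ
  have hΔ' : ∀ T, 0 < T → 0 < Δ T := fun T hT => (hΔ T hT).1
  refine ⟨AcrossScales.isLAN_observationLaw hΘ_pos hmodel hΔ' hmicro hϑΘ, ?_, fun T hT => ?_,
    AcrossScales.isLAN_pathLaw hΘ_pos (fun ϑ' h => (hmodel ϑ' h).isProbabilityMeasure)
      (fun ϑ' h => (hmodel ϑ' h).poisson) hϑΘ⟩
  -- The factor `T` cancels in the ratio, leaving `ϑ` times the information at time `1`.
  · rw [isEquivalent_iff_tendsto_one]
    · have h := (hM.tendsto_information hϑ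
        (AcrossScales.tendsto_nhdsGT_zero_of_pos hΔ' hmicro)).mul_const ϑ
      rw [one_div_mul_cancel hϑ.ne'] at h
      refine h.congr' ?_
      filter_upwards [eventually_gt_atTop 0] with T hT
      rw [Pi.div_apply, AcrossScales.information_eq_mul ϑ T]
      field_simp
    · filter_upwards [eventually_gt_atTop 0] with T hT using (div_pos hT hϑ).ne'
  · have h := (hM.tendsto_information hϑ (l := 𝓝[>] (0 : ℝ)) (D := id) tendsto_id).const_mul T
    rw [mul_one_div] at h
    refine h.congr fun δ => ?_
    rw [AcrossScales.information_eq_mul ϑ T]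
    rfl
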